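/- Let $k,n,m\ge 2$ be integers with $n<m$ and $n,m$ coprime. Let $$G=J(k,n,m)=\langle s,t,u\mid s^k=t^n=u^m=1,\ stu=tus=ust\rangle,$$ and let $W(k,n,m)$ be the toric reflection group $$W(k,n,m)=\Big\langle x_1,\dots,x_n\ \Big|\ x_i^k=1\ (1\le i\le n),\ \underbrace{x_1x_2\cdots}_{m\text{ factors}}=\underbrace{x_2x_3\cdots}_{m\text{ factors}}=\dots=\underbrace{x_nx_1\cdots}_{m\text{ factors}}\Big\rangle$$ (indices taken modulo $n$). Put $c=(x_1x_2\cdots x_n)^m\in W(k,n,m)$, and let $\overline{W(k,n,m)}$ be the quotient of $W(k,n,m)$ by the extra relation $c=1$. Let $$W_{k,n,m}=\langle r_1,r_2,r_3\mid r_1^2=r_2^2=r_3^2=(r_1r_2)^k=(r_2r_3)^n=(r_3r_1)^m=1\rangle$$ be the rank-three triangle Coxeter group and $W_{k,n,m}^+$ its alternating subgroup, i.e. the subgroup of elements of even length. Let $p\colon G\to W_{k,n,m}^+$ be the homomorphism $s\mapsto r_1r_2$, $t\mapsto r_2r_3$, $u\mapsto r_3r_1$; let $\iota\colon W(k,n,m)\to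 G$ be the homomorphism $x_i\mapsto t^{i-1}st^{1-i}$; let $q=p\circ\iota$. One has $q(c)=1$; let $\varphi\colon\overline{W(k,n,m)}\to W_{k,n,m}^+$ be the homomorphism induced by $q$. Then: 1. $\varphi$ is an isomorphism. 2. There is a commutative diagram $$\begin{array}{ccccccccc}1&\to&\langle stu\rangle&\to& G&\xrightarrow{\ p\ }&W_{k,n,m}^+&\to&1\\ &&\uparrow&&\uparrow{\scriptstyle\iota}&&\uparrow{\scriptstyle\mathrm{id}}&&\\ 1&\to&\langle c\rangle&\to& W(k,n,m)&\xrightarrow{\ q\ }&W_{k,n,m}^+&\to&1\end{array}$$ in which both rows are short exact sequences (the maps out of $\langle stu\rangle$ and $\langle c\rangle$ being the inclusions), $\iota$ is injective, and the left vertical map is injective. 3. $Z(W(k,n,m))=\langle c\rangle$ and $Z(G)=\langle stu\rangle$; in particular both centers are cyclic. 4. The diagram induces isomorphisms $$G/Z(G)\cong W(k,n,m)/Z(W(k,n,m))=\overline{W(k,n,m)}\cong W_{k,n,m}^+ .$$ -/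

import Mathlib

/-! ### The parent J-group `⟨s, t, u ∣ s^a = t^b = u^c = 1, stu = tus = ust⟩` -/

/-- The relators of the parent J-group; the generators `s, t, u` are indexed by `0, 1, 2`. -/
def parentJRels (a b c : ℕ) : Set (FreeGroup (Fin 3)) :=
  let s : FreeGroup (Fin 3) := FreeGroup.of 0
  let t : FreeGroup (Fin 3) := FreeGroup.of 1
  let u : FreeGroup (Fin 3) := FreeGroup.of 2
  {s ^ a, t ^ b, u ^ c, (s * t * u) * (t * u * s)⁻¹, (t * u * s) * (u * s * t)⁻¹}

/-- The parent J-group `J(a, b, c)`. -/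
abbrev ParentJ (a b c : ℕ) : Type := PresentedGroup (parentJRels a b c)

namespace ParentJ

/-- The generator `s`. -/
def s (a b c : ℕ) : ParentJ a b c := PresentedGroup.of 0

/-- The generator `t`. -/
def t (a b c : ℕ) : ParentJ a b c := PresentedGroup.of 1

/-- The generator `u`. -/
def u (a b c : ℕ) : ParentJ a b c := PresentedGroup.of 2

variable (a b c : ℕ)

theorem t_pow : t a b c ^ b = 1 := by
  have h := PresentedGroup.one_of_mem (rels := parentJRels a b c)
    (x := FreeGroup.of 1 ^ b) (by simp [parentJRels])
  simpa [s, t, u, PresentedGroup.of] using h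

theorem s_pow : s a b c ^ a = 1 := by
  have h := PresentedGroup.one_of_mem (rels := parentJRels a b c)
    (x := FreeGroup.of 0 ^ a) (by simp [parentJRels])
  simpa [s, t, u, PresentedGroup.of] using h

theorem u_pow : u a b c ^ c = 1 := by
  have h := PresentedGroup.one_of_mem (rels := parentJRels a b c)
    (x := FreeGroup.of 2 ^ c) (by simp [parentJRels])
  simpa [s, t, u, PresentedGroup.of] using h

theorem stu_eq_tus : s a b c * t a b c * u a b c = t a b c * u a b c * s a b c := by
  have h := PresentedGroup.one_of_mem (rels := parentJRels a b c)
    (x := (FreeGroup.of 0 * FreeGroup.of 1 * FreeGroup.of 2) *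
      (FreeGroup.of 1 * FreeGroup.of 2 * FreeGroup.of 0)⁻¹) (by simp [parentJRels])
  rw [map_mul, map_inv, mul_inv_eq_one] at h
  simpa [s, t, u, PresentedGroup.of] using h

theorem tus_eq_ust : t a b c * u a b c * s a b c = u a b c * s a b c * t a b c := by
  have h := PresentedGroup.one_of_mem (rels := parentJRels a b c)
    (x := (FreeGroup.of 1 * FreeGroup.of 2 * FreeGroup.of 0) *
      (FreeGroup.of 2 * FreeGroup.of 0 * FreeGroup.of 1)⁻¹) (by simp [parentJRels])
  rw [map_mul, map_inv, mul_inv_eq_one] at h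
  simpa [s, t, u, PresentedGroup.of] using h

end ParentJ

/-! ### Toric reflection groups -/

/-- The word `x_i x_{i+1} ⋯ x_{i+l-1}` with `l` factors, indices taken modulo `n`. -/
def toricWord (n : ℕ) (i : ZMod n) (l : ℕ) : FreeGroup (ZMod n) :=
  ((List.range l).map fun j : ℕ => FreeGroup.of (i + (j : ZMod n))).prod

/-- The relators of the toric reflection group `W(k, n, m)`: `x_i ^ k = 1` for all `i`, and all
the words `x_i x_{i+1} ⋯` with `m` factors are equal. -/
def toricRels (k n m : ℕ) : Set (FreeGroup (ZMod n)) :=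
  (Set.range fun i : ZMod n => FreeGroup.of i ^ k) ∪
    Set.range fun i : ZMod n => toricWord n i m * (toricWord n (i + 1) m)⁻¹

/-- The toric reflection group `W(k, n, m)`, on generators `x_i` with `i` modulo `n`. -/
abbrev ToricReflectionGroup (k n m : ℕ) : Type := PresentedGroup (toricRels k n m)

namespace ToricReflectionGroup

/-- The generator `x_i` of `W(k, n, m)`, `i` being taken modulo `n`. -/
def x (k n m : ℕ) (i : ZMod n) : ToricReflectionGroup k n m := PresentedGroup.of i

/-- The element `c = (x_1 x_2 ⋯ x_n) ^ m` of `W(k, n, m)`. -/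
def c (k n m : ℕ) : ToricReflectionGroup k n m :=
  ((List.range n).map fun j : ℕ => x k n m (1 + (j : ZMod n))).prod ^ m

end ToricReflectionGroup

/-- The quotient of `W(k, n, m)` by the extra relation `c = 1`. -/
abbrev ToricQuotient (k n m : ℕ) : Type :=
  ToricReflectionGroup k n m ⧸ Subgroup.normalClosure {ToricReflectionGroup.c k n m}

/-! ### The triangle Coxeter group and its alternating subgroup -/

/-- The Coxeter matrix of rank three with `m(r₁, r₂) = k`, `m(r₂, r₃) = n`, `m(r₃, r₁) = m`
(the simple reflections `r₁, r₂, r₃` are indexed by `0, 1, 2`). -/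
def triangleMatrix (k n m : ℕ) (hk : 2 ≤ k) (hn : 2 ≤ n) (hm : 2 ≤ m) :
    CoxeterMatrix (Fin 3) where
  M := !![1, k, m; k, 1, n; m, n, 1]
  isSymm := by
    ext i j
    fin_cases i <;> fin_cases j <;> rfl
  diagonal i := by fin_cases i <;> rfl
  off_diagonal i j h := by
    fin_cases i <;> fin_cases j <;> simp at h ⊢ <;> omega

/-- The triangle Coxeter group `W_{k,n,m}`. -/
abbrev TriangleCoxeter (k n m : ℕ) (hk : 2 ≤ k) (hn : 2 ≤ n) (hm : 2 ≤ m) : Type :=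
  (triangleMatrix k n m hk hn hm).Group

/-- The simple reflections of `W_{k,n,m}`; `triangleR _ _ _ 0` is `r₁`, and so on. -/
def triangleR {k n m : ℕ} (hk : 2 ≤ k) (hn : 2 ≤ n) (hm : 2 ≤ m) (i : Fin 3) :
    TriangleCoxeter k n m hk hn hm :=
  (triangleMatrix k n m hk hn hm).simple i

/-- The alternating subgroup `W_{k,n,m}^+`: the elements of even length. -/
def triangleAlt (k n m : ℕ) (hk : 2 ≤ k) (hn : 2 ≤ n) (hm : 2 ≤ m) :
    Subgroup (TriangleCoxeter k n m hk hn hm) :=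
  (triangleMatrix k n m hk hn hm).toCoxeterSystem.lengthParity.ker

theorem triangleR_mul_pow {k n m : ℕ} (hk : 2 ≤ k) (hn : 2 ≤ n) (hm : 2 ≤ m) (i j : Fin 3) :
    (triangleR hk hn hm i * triangleR hk hn hm j) ^ triangleMatrix k n m hk hn hm i j = 1 :=
  (triangleMatrix k n m hk hn hm).toCoxeterSystem.simple_mul_simple_pow i j

theorem triangleR_mul_self {k n m : ℕ} (hk : 2 ≤ k) (hn : 2 ≤ n) (hm : 2 ≤ m) (i : Fin 3) :
    triangleR hk hn hm i * triangleR hk hn hm i = 1 :=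
  (triangleMatrix k n m hk hn hm).toCoxeterSystem.simple_mul_simple_self i

theorem triangleR_mul_mem {k n m : ℕ} (hk : 2 ≤ k) (hn : 2 ≤ n) (hm : 2 ≤ m) (i j : Fin 3) :
    triangleR hk hn hm i * triangleR hk hn hm j ∈ triangleAlt k n m hk hn hm := by
  have h : ∀ i, (triangleMatrix k n m hk hn hm).toCoxeterSystem.lengthParity
      (triangleR hk hn hm i) = Multiplicative.ofAdd 1 :=
    (triangleMatrix k n m hk hn hm).toCoxeterSystem.lengthParity_simple
  rw [triangleAlt, MonoidHom.mem_ker, map_mul, h, h]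
  rfl

/-- The element `r_i r_j` of the alternating subgroup. -/
def triangleRot {k n m : ℕ} (hk : 2 ≤ k) (hn : 2 ≤ n) (hm : 2 ≤ m) (i j : Fin 3) :
    triangleAlt k n m hk hn hm :=
  ⟨triangleR hk hn hm i * triangleR hk hn hm j, triangleR_mul_mem hk hn hm i j⟩

/-! ### The three homomorphisms -/

/-- The homomorphism `J(k, n, m) → W_{k,n,m}^+` with `s ↦ r₁ r₂`, `t ↦ r₂ r₃`, `u ↦ r₃ r₁`. -/
def parentJToAlt {k n m : ℕ} (hk : 2 ≤ k) (hn : 2 ≤ n) (hm : 2 ≤ m) :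
    ParentJ k n m →* triangleAlt k n m hk hn hm :=
  PresentedGroup.toGroup
    (f := ![triangleRot hk hn hm 0 1, triangleRot hk hn hm 1 2, triangleRot hk hn hm 2 0]) <| by
    have e := triangleR_mul_self hk hn hm
    have e' : ∀ i y, triangleR hk hn hm i * (triangleR hk hn hm i * y) = y := fun i y => by
      rw [← mul_assoc, e, one_mul]
    intro r hr
    simp only [parentJRels, Set.mem_insert_iff, Set.mem_singleton_iff] at hr
    rcases hr with rfl | rfl | rfl | rfl | rfl
    · simpa [triangleRot, Subtype.ext_iff] using! triangleR_mul_pow hk hn hm 0 1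
    · simpa [triangleRot, Subtype.ext_iff] using! triangleR_mul_pow hk hn hm 1 2
    · simpa [triangleRot, Subtype.ext_iff] using! triangleR_mul_pow hk hn hm 2 0
    · rw [map_mul, map_inv, mul_inv_eq_one]
      simp [triangleRot, mul_assoc, e, e']
    · rw [map_mul, map_inv, mul_inv_eq_one]
      simp [triangleRot, mul_assoc, e, e']

/-- The element `t ^ (i - 1) s t ^ (1 - i)` of `J(k, n, m)`, for `i` modulo `n`. -/
def toricImage (k n m : ℕ) (i : ZMod n) : ParentJ k n m :=
  ParentJ.t k n m ^ (i - 1).val * ParentJ.s k n m * (ParentJ.t k n m ^ (i - 1).val)⁻¹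

theorem toricImage_pow (k n m : ℕ) (i : ZMod n) : toricImage k n m i ^ k = 1 := by
  rw [toricImage, conj_pow, ParentJ.s_pow, mul_one, mul_inv_cancel]

theorem parentJ_t_pow_val_add (k n m : ℕ) [NeZero n] (i j : ZMod n) :
    ParentJ.t k n m ^ (i + j).val = ParentJ.t k n m ^ i.val * ParentJ.t k n m ^ j.val := by
  rw [ZMod.val_add, ← pow_add, ← pow_eq_pow_mod _ (ParentJ.t_pow k n m)]

theorem parentJ_t_pow_val_natCast (k n m : ℕ) (j : ℕ) :
    ParentJ.t k n m ^ (j : ZMod n).val = ParentJ.t k n m ^ j := by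
  rw [ZMod.val_natCast, ← pow_eq_pow_mod _ (ParentJ.t_pow k n m)]

theorem toricImage_prod (k n m : ℕ) [NeZero n] (i : ZMod n) (l : ℕ) :
    ((List.range l).map fun j : ℕ => toricImage k n m (i + (j : ZMod n))).prod =
      ParentJ.t k n m ^ (i - 1).val * (ParentJ.s k n m * ParentJ.t k n m) ^ l *
        (ParentJ.t k n m ^ l)⁻¹ * (ParentJ.t k n m ^ (i - 1).val)⁻¹ := by
  induction l with
  | zero => simp
  | succ l ih =>
    have h : i + (l : ZMod n) - 1 = (i - 1) + (l : ZMod n) := by ring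
    rw [List.range_succ, List.map_append, List.prod_append, ih]
    simp only [List.map_cons, List.map_nil, List.prod_cons, List.prod_nil, mul_one, toricImage]
    rw [h, parentJ_t_pow_val_add, parentJ_t_pow_val_natCast,
      pow_succ (ParentJ.s k n m * ParentJ.t k n m), pow_succ (ParentJ.t k n m)]
    rw [mul_inv_rev, mul_inv_rev]
    simp only [mul_assoc, inv_mul_cancel_left, mul_inv_cancel_left]

theorem parentJ_st_pow (k n m : ℕ) :
    (ParentJ.s k n m * ParentJ.t k n m) ^ m =
      (ParentJ.s k n m * ParentJ.t k n m * ParentJ.u k n m) ^ m := by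
  have h : Commute (ParentJ.s k n m * ParentJ.t k n m) (ParentJ.u k n m) := by
    have h1 := ParentJ.stu_eq_tus k n m
    have h2 := ParentJ.tus_eq_ust k n m
    rw [Commute, SemiconjBy, h1, h2, mul_assoc]
  rw [h.mul_pow, ParentJ.u_pow, mul_one]

theorem parentJ_commute_t (k n m : ℕ) :
    Commute (ParentJ.t k n m) (ParentJ.s k n m * ParentJ.t k n m * ParentJ.u k n m) := by
  have h1 := ParentJ.stu_eq_tus k n m
  have h2 := ParentJ.tus_eq_ust k n m
  rw [Commute, SemiconjBy]
  nth_rewrite 1 [h1, h2]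
  rw [h1]
  simp only [mul_assoc]

/-- The homomorphism `W(k, n, m) → J(k, n, m)` with `x_i ↦ t ^ (i - 1) s t ^ (1 - i)`. -/
def toricToParentJ {k n m : ℕ} (hn : 2 ≤ n) : ToricReflectionGroup k n m →* ParentJ k n m :=
  PresentedGroup.toGroup (f := toricImage k n m) <| by
    have : NeZero n := ⟨by omega⟩
    have key : ∀ i, FreeGroup.lift (toricImage k n m) (toricWord n i m) =
        (ParentJ.s k n m * ParentJ.t k n m * ParentJ.u k n m) ^ m *
          (ParentJ.t k n m ^ m)⁻¹ := fun i => by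
      have hc := ((parentJ_commute_t k n m).pow_pow (i - 1).val m).eq
      have hd := (Commute.refl (ParentJ.t k n m)).pow_pow (i - 1).val m
      rw [toricWord, map_list_prod, List.map_map]
      have := toricImage_prod k n m i m
      simp only [Function.comp_def, FreeGroup.lift_apply_of]
      rw [this, parentJ_st_pow, hc, mul_assoc, mul_assoc, ← mul_assoc _ _ (_ ^ (i - 1).val)⁻¹,
        hd.inv_right.eq, mul_assoc (ParentJ.t k n m ^ m)⁻¹, mul_inv_cancel, mul_one, mul_assoc]
    rintro r (⟨i, rfl⟩ | ⟨i, rfl⟩)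
    · simpa using toricImage_pow k n m i
    · simp only [map_mul, map_inv, key, mul_inv_cancel]

/-- The homomorphism `W(k, n, m) → W_{k,n,m}^+` obtained by composing
`W(k, n, m) → J(k, n, m)` with `J(k, n, m) → W_{k,n,m}^+`. -/
def toricToAlt {k n m : ℕ} (hk : 2 ≤ k) (hn : 2 ≤ n) (hm : 2 ≤ m) :
    ToricReflectionGroup k n m →* triangleAlt k n m hk hn hm :=
  (parentJToAlt hk hn hm).comp (toricToParentJ hn)

theorem toricToAlt_c {k n m : ℕ} (hk : 2 ≤ k) (hn : 2 ≤ n) (hm : 2 ≤ m) :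
    toricToAlt hk hn hm (ToricReflectionGroup.c k n m) = 1 := by
  have : NeZero n := ⟨by omega⟩
  have h1 : toricToParentJ hn (ToricReflectionGroup.c k n m) =
      (ParentJ.s k n m * ParentJ.t k n m * ParentJ.u k n m) ^ (m * n) := by
    rw [ToricReflectionGroup.c, map_pow, map_list_prod, List.map_map]
    have h : ∀ i, toricToParentJ hn (ToricReflectionGroup.x k n m i) = toricImage k n m i :=
      fun i => PresentedGroup.toGroup.of _
    have := toricImage_prod k n m 1 n
    simp only [Function.comp_def, h]
    rw [this]
    simp only [sub_self, ZMod.val_zero, pow_zero, one_mul, ParentJ.t_pow, inv_one, mul_one]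
    rw [← pow_mul, mul_comm, pow_mul, parentJ_st_pow, ← pow_mul]
  have h2 : parentJToAlt hk hn hm
      (ParentJ.s k n m * ParentJ.t k n m * ParentJ.u k n m) = 1 := by
    have e := triangleR_mul_self hk hn hm
    have e' : ∀ i y, triangleR hk hn hm i * (triangleR hk hn hm i * y) = y := fun i y => by
      rw [← mul_assoc, e, one_mul]
    simp [ParentJ.s, ParentJ.t, ParentJ.u, parentJToAlt, triangleRot, mul_assoc, e, e']
  rw [toricToAlt, MonoidHom.comp_apply, h1, map_pow, h2, one_pow]

/-- The homomorphism `φ` from the quotient of `W(k, n, m)` by the relation `c = 1` to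
`W_{k,n,m}^+` induced by `W(k, n, m) → W_{k,n,m}^+`. -/
def toricPhi {k n m : ℕ} (hk : 2 ≤ k) (hn : 2 ≤ n) (hm : 2 ≤ m) :
    ToricQuotient k n m →* triangleAlt k n m hk hn hm :=
  QuotientGroup.lift _ (toricToAlt hk hn hm) <| by
    apply Subgroup.normalClosure_le_normal
    simpa using toricToAlt_c hk hn hm

/-! ### The geometric representation of a Coxeter group -/

namespace CoxeterMatrix

/-! Everything follows from three facts: the kernel of `p` is `⟨stu⟩`, the map `ι` is injective, and
`W_{k,n,m}^+` has trivial center.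

Kernel of `p`. An involution `τ` of `G` inverts `s`, `t` and the central element `stu`, so it acts
on `G/⟨stu⟩`. Letting `r₁, r₂, r₃` act as `sτ`, `τ`, `τt` makes the Coxeter group act on these
cosets, and the composite with `p` is left translation by `G`. An element of the kernel thus fixes
the trivial coset, i.e. lies in `⟨stu⟩` (`ker_parentJToAlt`).

Injectivity of `ι`. Let `σ` be the shift `x_i ↦ x_{i+1}` of `W(k,n,m)`. The defining relations make
`(x₁σ)^m` commute with `x₁` and `σ`. Adjoining a central `m`-th root `z` of it allows `s ↦ x₁`, `t ↦
σ`, `u ↦ (x₁σ)⁻¹z`, a homomorphism on `G` whose composite with `ι` is the faithful left regular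
action (`toricToParentJ_injective`).

Kernel and image of `q`. One has `ι(c) = (stu)^{nm}`. A map `G → ℤ/n × ℤ/m` killing the image of `ι`
and sending `stu` to `(1,1)` shows, by coprimality, that no smaller positive power of `stu` lies in
that image; hence `ker q = ⟨c⟩`. Bézout gives surjectivity.

Center of `W_{k,n,m}^+`. In the geometric representation a central element is diagonal on the simple
roots, with determinant `1`. If all eigenvalues are positive it is trivial, since a nontrivial
element makes some simple root negative. Negative eigenvalues force `k = n = 2`, a dihedral group
with `m` odd, which is treated by hand (`center_triangleAlt`). Both centers then equal the kernels,
and the quotients follow. -/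

theorem sin_pi_div_pos {B : Type*} (M : CoxeterMatrix B) {i j : B} (hij : i ≠ j) (h : M i j ≠ 0) :
    0 < Real.sin (Real.pi / M i j) := by
  have h1 : M i j ≠ 1 := M.off_diagonal i j hij
  have h2 : (2 : ℝ) ≤ M i j := by exact_mod_cast (by omega : 2 ≤ M i j)
  apply Real.sin_pos_of_pos_of_lt_pi
  · positivity
  · rw [div_lt_iff₀ (by positivity)]
    nlinarith [Real.pi_pos]

variable {B : Type*} [Fintype B] [DecidableEq B] (M : CoxeterMatrix B)

/-- The linear form `v ↦ ⟨α_i, v⟩` for the bilinear form with `⟨α_i, α_j⟩ = -cos (π / M i j)`. -/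
noncomputable def rootForm (i : B) : (B → ℝ) →ₗ[ℝ] ℝ :=
  ∑ j, (-Real.cos (Real.pi / M i j)) • LinearMap.proj j

theorem rootForm_single (i j : B) :
    M.rootForm i (Pi.single j 1) = -Real.cos (Real.pi / M i j) := by
  simp [rootForm, Pi.single_apply]

theorem rootForm_single_self (i : B) : M.rootForm i (Pi.single i 1) = 1 := by
  simp [rootForm_single]

/-- The reflection of `B → ℝ` attached to the simple root `α_i`. -/
noncomputable def rootReflection (i : B) : Module.End ℝ (B → ℝ) :=
  LinearMap.id - (2 : ℝ) • (M.rootForm i).smulRight (Pi.single i 1)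

theorem rootReflection_apply (i : B) (v : B → ℝ) :
    M.rootReflection i v = v - (2 * M.rootForm i v) • Pi.single i 1 := by
  simp [rootReflection, mul_smul]

theorem rootReflection_single_self (i : B) :
    M.rootReflection i (Pi.single i 1) = -Pi.single i 1 := by
  rw [rootReflection_apply, rootForm_single_self]
  module

theorem rootReflection_single (i j : B) :
    M.rootReflection i (Pi.single j 1) =
      Pi.single j 1 + (2 * Real.cos (Real.pi / M i j)) • Pi.single i 1 := by
  rw [rootReflection_apply, rootForm_single]
  module

theorem rootReflection_of_rootForm_eq_zero {i : B} {v : B → ℝ} (h : M.rootForm i v = 0) :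
    M.rootReflection i v = v := by
  simp [rootReflection_apply, h]

theorem rootReflection_mul_self (i : B) : M.rootReflection i * M.rootReflection i = 1 := by
  refine LinearMap.ext fun v => ?_
  simp only [Module.End.mul_apply, Module.End.one_apply]
  rw [rootReflection_apply M i v, map_sub, map_smul, rootReflection_single_self,
    rootReflection_apply]
  module

/-- The coefficients are Chebyshev quotients `sin(qθ)/sin θ`; multiplying by `sin θ` clears the
denominator and reduces the induction to addition formulas. -/
theorem sin_smul_rootReflection_mul_pow_single (i j : B) (p : ℕ) :
    Real.sin (Real.pi / M i j) •
        ((M.rootReflection i * M.rootReflection j) ^ p) (Pi.single i 1) =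
      Real.sin ((2 * p + 1) * (Real.pi / M i j)) • (Pi.single i 1 : B → ℝ) +
        Real.sin (2 * p * (Real.pi / M i j)) • Pi.single j 1 := by
  induction p with
  | zero => simp
  | succ p ih =>
    rw [pow_succ', Module.End.mul_apply, ← map_smul, ih, Module.End.mul_apply]
    simp only [map_add, map_smul, rootReflection_single_self, rootReflection_single, map_neg,
      M.symmetric j i]
    set θ := Real.pi / (M i j : ℝ)
    have e1 : Real.sin ((2 * (p + 1 : ℕ) + 1) * θ) =
        2 * Real.cos θ * Real.sin (2 * (p + 1 : ℕ) * θ) - Real.sin ((2 * p + 1) * θ) := by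
      have := Real.sin_add (2 * (p + 1 : ℕ) * θ) θ
      have h2 := Real.sin_sub (2 * (p + 1 : ℕ) * θ) θ
      rw [show (2 * ((p + 1 : ℕ) : ℝ) + 1) * θ = 2 * (p + 1 : ℕ) * θ + θ by ring,
        show (2 * (p : ℝ) + 1) * θ = 2 * (p + 1 : ℕ) * θ - θ by push_cast; ring]
      linarith
    have e2 : Real.sin (2 * (p + 1 : ℕ) * θ) =
        2 * Real.cos θ * Real.sin ((2 * p + 1) * θ) - Real.sin (2 * p * θ) := by
      have := Real.sin_add ((2 * p + 1) * θ) θ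
      have h2 := Real.sin_sub ((2 * p + 1) * θ) θ
      rw [show (2 * ((p + 1 : ℕ) : ℝ)) * θ = (2 * p + 1) * θ + θ by push_cast; ring,
        show (2 * (p : ℝ)) * θ = (2 * p + 1) * θ - θ by ring]
      linarith
    rw [e1, e2]
    module

theorem rootReflection_mul_pow_single {i j : B} (hij : i ≠ j) (h : M i j ≠ 0) :
    ((M.rootReflection i * M.rootReflection j) ^ M i j) (Pi.single i 1) = Pi.single i 1 := by
  have h1 := M.sin_smul_rootReflection_mul_pow_single i j (M i j)
  have h0 : (M i j : ℝ) ≠ 0 := by exact_mod_cast h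
  rw [show (2 * (M i j : ℝ) + 1) * (Real.pi / M i j) = Real.pi / M i j + 2 * Real.pi by
      field_simp; ring,
    show (2 * (M i j : ℝ)) * (Real.pi / M i j) = 2 * Real.pi by field_simp, Real.sin_add_two_pi,
    Real.sin_two_pi, zero_smul, add_zero] at h1
  exact smul_right_injective _ (M.sin_pi_div_pos hij h).ne' h1

/-- The form is nondegenerate on the plane of `α_i` and `α_j`, since its Gram determinant is `sin² θ
≠ 0`. So every vector splits into a part in the plane and a part fixed by both reflections. -/
theorem rootReflection_mul_pow (hM : ∀ i j, M i j ≠ 0) (i j : B) :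
    (M.rootReflection i * M.rootReflection j) ^ M i j = 1 := by
  rcases eq_or_ne i j with rfl | hij
  · rw [rootReflection_mul_self, one_pow]
  have hs := M.sin_pi_div_pos hij (hM i j)
  have hj : ((M.rootReflection i * M.rootReflection j) ^ M i j) (Pi.single j 1) =
      Pi.single j 1 := by
    have h1 := M.rootReflection_mul_pow_single hij.symm (hM j i)
    rw [M.symmetric j i] at h1
    -- The two products are mutually inverse, so a vector fixed by a power of one is fixed by the
    -- same power of the other.
    have h2 : (M.rootReflection i * M.rootReflection j) ^ M i j *
        (M.rootReflection j * M.rootReflection i) ^ M i j = 1 := by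
      have : (M.rootReflection i * M.rootReflection j) *
          (M.rootReflection j * M.rootReflection i) = 1 := by
        rw [mul_assoc, ← mul_assoc (M.rootReflection j), rootReflection_mul_self, one_mul,
          rootReflection_mul_self]
      have hc : Commute (M.rootReflection i * M.rootReflection j)
          (M.rootReflection j * M.rootReflection i) := by
        rw [Commute, SemiconjBy, this, mul_assoc, ← mul_assoc (M.rootReflection i),
          rootReflection_mul_self, one_mul, rootReflection_mul_self]
      rw [← hc.mul_pow, this, one_pow]
    have h3 := LinearMap.congr_fun h2 (Pi.single j 1)
    rwa [Module.End.mul_apply, h1] at h3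
  refine LinearMap.ext fun v => ?_
  set θ := Real.pi / (M i j : ℝ) with hθ
  have hsc := Real.sin_sq_add_cos_sq θ
  -- Solution of the 2×2 Gram system with entries `1` and `-cos θ`: subtracting `x α_i + y α_j`
  -- kills both root forms.
  set x := (M.rootForm i v + Real.cos θ * M.rootForm j v) / Real.sin θ ^ 2
  set y := (M.rootForm j v + Real.cos θ * M.rootForm i v) / Real.sin θ ^ 2
  set v₀ := v - (x • Pi.single i (1 : ℝ) + y • Pi.single j (1 : ℝ)) with hv₀
  have hi0 : M.rootForm i v₀ = 0 := by
    simp only [hv₀, map_sub, map_add, map_smul, rootForm_single_self, rootForm_single,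
      smul_eq_mul, ← hθ, x, y]
    field_simp
    rw [show Real.sin θ ^ 2 = 1 - Real.cos θ ^ 2 by linarith]
    ring
  have hj0 : M.rootForm j v₀ = 0 := by
    simp only [hv₀, map_sub, map_add, map_smul, rootForm_single_self, rootForm_single,
      smul_eq_mul, M.symmetric j i, ← hθ, x, y]
    field_simp
    rw [show Real.sin θ ^ 2 = 1 - Real.cos θ ^ 2 by linarith]
    ring
  have hfix : ∀ p : ℕ, ((M.rootReflection i * M.rootReflection j) ^ p) v₀ = v₀ := fun p => by
    induction p with
    | zero => simp
    | succ p ih =>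
      rw [pow_succ', Module.End.mul_apply, ih, Module.End.mul_apply,
        M.rootReflection_of_rootForm_eq_zero hj0, M.rootReflection_of_rootForm_eq_zero hi0]
  have hv : v = v₀ + (x • Pi.single i (1 : ℝ) + y • Pi.single j (1 : ℝ)) := by
    rw [hv₀, sub_add_cancel]
  rw [Module.End.one_apply]
  nth_rw 1 [hv]
  rw [map_add, map_add, map_smul, map_smul, hfix, hj, M.rootReflection_mul_pow_single hij (hM i j),
    ← hv]

theorem det_rootReflection (i : B) : LinearMap.det (M.rootReflection i) = -1 := by
  have h : M.rootReflection i =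
      LinearMap.transvection ((-2 : ℝ) • M.rootForm i) (Pi.single i 1) := by
    refine LinearMap.ext fun v => ?_
    rw [rootReflection_apply, LinearMap.transvection.apply, LinearMap.smul_apply, smul_eq_mul]
    module
  rw [h, LinearMap.transvection.det, LinearMap.smul_apply, rootForm_single_self]
  norm_num

end CoxeterMatrix

/-! ### Signs of roots and the commutants of rotations -/

namespace CoxeterSystem

/-- A word in two letters can be stripped from the right of `w` until neither letter is a right
descent any more. -/
theorem exists_strip_alternatingWord {B W : Type*} [Group W] {M : CoxeterMatrix B}
    (cs : CoxeterSystem M W) {w : W} {i j : B} (hi : ¬ cs.IsRightDescent w i)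
    (hj : cs.IsRightDescent w j) (hij0 : M i j ≠ 0) :
    ∃ (v : W) (p : ℕ), 0 < p ∧ p < M i j ∧ w = v * cs.wordProd (alternatingWord i j p) ∧
      cs.length v + p = cs.length w ∧ ¬ cs.IsRightDescent v i ∧ ¬ cs.IsRightDescent v j := by
  -- `V p` is `w` with an alternating tail of `p` letters ending in `j` removed; the `p` chosen
  -- below is maximal with every removed letter shortening `w`.
  set V : ℕ → W := fun p => w * (cs.wordProd (alternatingWord i j p))⁻¹ with hV
  have hVs : ∀ p, V (p + 1) = V p * cs.simple (if Even p then j else i) := fun p => by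
    simp only [hV, alternatingWord_succ', wordProd_cons, mul_inv_rev, inv_simple, mul_assoc]
  have hVw : ∀ p, w = V p * cs.wordProd (alternatingWord i j p) := fun p => by simp [hV]
  have hlen : ∀ p, cs.length w ≤ cs.length (V p) + p := fun p => by
    calc cs.length w = cs.length (V p * cs.wordProd (alternatingWord i j p)) := by rw [← hVw]
      _ ≤ cs.length (V p) + cs.length (cs.wordProd (alternatingWord i j p)) :=
        cs.length_mul_le _ _
      _ ≤ _ := by
        have := cs.length_wordProd_le (alternatingWord i j p)
        rw [length_alternatingWord] at this
        omega
  have hne : i ≠ j := by rintro rfl; exact hi hj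
  have h1 : M i j ≠ 1 := M.off_diagonal i j hne
  set P : ℕ → Prop := fun p => cs.length (V p) + p = cs.length w with hP
  classical
  set p := Nat.findGreatest P (M i j) with hp
  have hP1 : P 1 := by
    have h := cs.isRightDescent_iff.1 hj
    simpa [hP, hV, alternatingWord] using h
  have hp1 : 1 ≤ p := Nat.le_findGreatest (by omega) hP1
  have hPp : P p := Nat.findGreatest_spec (P := P) (m := 1) (n := M i j) (by omega) hP1
  -- A tail of full length `M i j` could be rewritten by the braid relation to end in `i`, making
  -- `i` a right descent of `w`.
  have hpm : p < M i j := by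
    refine lt_of_le_of_ne (Nat.findGreatest_le _) fun heq => hi ?_
    have hw : w * cs.simple i = V p * cs.wordProd (alternatingWord i j (p - 1)) := by
      have hb := cs.wordProd_braidWord_eq i j
      rw [braidWord, braidWord, M.symmetric j i, ← heq] at hb
      have hs : alternatingWord j i p = (alternatingWord i j (p - 1)).concat i := by
        rw [← alternatingWord_succ, Nat.sub_add_cancel hp1]
      rw [hs, wordProd_concat] at hb
      nth_rw 1 [hVw p]
      rw [hb, mul_assoc, simple_mul_simple_cancel_right]
    have h2 := cs.length_mul_le (V p) (cs.wordProd (alternatingWord i j (p - 1)))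
    have h3 := cs.length_wordProd_le (alternatingWord i j (p - 1))
    rw [length_alternatingWord] at h3
    rw [IsRightDescent, hw]
    have : cs.length (V p) + p = cs.length w := hPp
    omega
  have hx : ¬ cs.IsRightDescent (V p) (if Even p then j else i) := by
    intro h
    rw [isRightDescent_iff, ← hVs] at h
    refine Nat.findGreatest_is_greatest (P := P) (n := M i j) (k := p + 1) (by omega) (by omega) ?_
    have : cs.length (V p) + p = cs.length w := hPp
    simp only [hP]
    omega
  -- Multiplying by this letter undoes the last strip and yields `V (p - 1)`, which is too long for
  -- this to be a descent.
  have hy : ¬ cs.IsRightDescent (V p) (if Even p then i else j) := by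
    intro h
    rw [isRightDescent_iff] at h
    obtain ⟨q, hq⟩ : ∃ q, p = q + 1 := ⟨p - 1, by omega⟩
    have hVq : V p * cs.simple (if Even p then i else j) = V q := by
      rw [hq, hVs]
      by_cases he : Even q <;> simp [he, Nat.even_add_one]
    rw [hVq] at h
    have h1 := hlen q
    have : cs.length (V p) + p = cs.length w := hPp
    omega
  refine ⟨V p, p, hp1, hpm, hVw p, hPp, ?_⟩
  by_cases he : Even p
  · simp only [he, if_true] at hx hy
    exact ⟨hy, hx⟩
  · simp only [he, if_false] at hx hy
    exact ⟨hx, hy⟩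

variable {B W : Type*} [Fintype B] [DecidableEq B] [Group W] {M : CoxeterMatrix B}
  (cs : CoxeterSystem M W) (hM : ∀ i j, M i j ≠ 0)

/-- The geometric representation. -/
noncomputable def geomRep : W →* Module.End ℝ (B → ℝ) :=
  cs.lift ⟨M.rootReflection, M.rootReflection_mul_pow hM⟩

theorem geomRep_simple (i : B) : cs.geomRep hM (cs.simple i) = M.rootReflection i :=
  cs.lift_apply_simple _ _

/-- The angles are at most `(p + 1)θ`, so for `p < M i j` they stay in `[0, π]` and both
coefficients are nonnegative. -/
theorem geomRep_alternatingWord (i j : B) (p : ℕ) :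
    Real.sin (Real.pi / M i j) •
        cs.geomRep hM (cs.wordProd (alternatingWord i j p)) (Pi.single i 1) =
      Real.sin ((if Even p then p + 1 else p : ℕ) * (Real.pi / M i j)) •
          (Pi.single i 1 : B → ℝ) +
        Real.sin ((if Even p then p else p + 1 : ℕ) * (Real.pi / M i j)) • Pi.single j 1 := by
  induction p with
  | zero => simp [alternatingWord]
  | succ p ih =>
    rw [alternatingWord_succ', wordProd_cons, map_mul, Module.End.mul_apply, ← map_smul, ih]
    set θ := Real.pi / (M i j : ℝ) with hθ
    have e : Real.sin ((p + 1 + 1 : ℕ) * θ) =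
        2 * Real.cos θ * Real.sin ((p + 1 : ℕ) * θ) - Real.sin (p * θ) := by
      have := Real.sin_add ((p + 1 : ℕ) * θ) θ
      have h2 := Real.sin_sub ((p + 1 : ℕ) * θ) θ
      rw [show ((p + 1 + 1 : ℕ) : ℝ) * θ = (p + 1 : ℕ) * θ + θ by push_cast; ring,
        show (p : ℝ) * θ = (p + 1 : ℕ) * θ - θ by push_cast; ring]
      linarith
    by_cases hp : Even p
    · have hp' : ¬ Even (p + 1) := by simpa [Nat.even_add_one] using hp
      simp only [hp, hp', if_true, if_false, geomRep_simple, map_add, map_smul,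
        M.rootReflection_single_self, M.rootReflection_single, M.symmetric j i, ← hθ, e]
      module
    · have hp' : Even (p + 1) := by simpa [Nat.even_add_one] using hp
      simp only [hp, hp', if_true, if_false, geomRep_simple, map_add, map_smul,
        M.rootReflection_single_self, M.rootReflection_single, ← hθ, e]
      module

/-- If `i` is not a right descent of `w` then `w` maps the simple root `α_i` to a nonnegative
combination of simple roots. -/
theorem geomRep_single_nonneg (w : W) (i : B) (hi : ¬ cs.IsRightDescent w i) :
    0 ≤ cs.geomRep hM w (Pi.single i 1) := by
  induction hl : cs.length w using Nat.strong_induction_on generalizing w i with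
  | _ l ih =>
  by_cases hw : w = 1
  · subst hw
    simp
  obtain ⟨j, hj⟩ := cs.exists_rightDescent_of_ne_one hw
  have hij : i ≠ j := by rintro rfl; exact hi hj
  -- The dihedral tail sends `α_i` to a nonnegative combination of `α_i` and `α_j`, and induction
  -- applies to the shorter `v` at both roots.
  obtain ⟨v, p, hp0, hpm, hv, hlv, hvi, hvj⟩ :=
    cs.exists_strip_alternatingWord hi hj (hM i j)
  have h1 := ih (cs.length v) (by omega) v i hvi rfl
  have h2 := ih (cs.length v) (by omega) v j hvj rfl
  have hs := M.sin_pi_div_pos hij (hM i j)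
  have hnn : ∀ q : ℕ, q ≤ M i j → 0 ≤ Real.sin (q * (Real.pi / M i j)) := fun q hq => by
    have : (0 : ℝ) < M i j := by exact_mod_cast Nat.pos_of_ne_zero (hM i j)
    have hq' : (q : ℝ) ≤ M i j := by exact_mod_cast hq
    apply Real.sin_nonneg_of_nonneg_of_le_pi
    · have := Real.pi_pos
      positivity
    · rw [← mul_div_assoc, div_le_iff₀ this]
      nlinarith [Real.pi_pos]
  have key : 0 ≤ Real.sin (Real.pi / M i j) • cs.geomRep hM w (Pi.single i 1) := by
    rw [hv, map_mul, Module.End.mul_apply, ← map_smul, geomRep_alternatingWord, map_add, map_smul,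
      map_smul]
    exact add_nonneg (smul_nonneg (hnn _ (by split_ifs <;> omega)) h1)
      (smul_nonneg (hnn _ (by split_ifs <;> omega)) h2)
  exact (smul_nonneg_iff_nonneg_of_pos_left hs).1 key

/-- At a right descent `i` of `w`, the element `w s_i` no longer has descent `i`, and it sends `α_i`
to `-w α_i`. -/
theorem exists_geomRep_single_nonpos {w : W} (hw : w ≠ 1) :
    ∃ i, cs.geomRep hM w (Pi.single i 1) ≤ 0 := by
  obtain ⟨i, hi⟩ := cs.exists_rightDescent_of_ne_one hw
  refine ⟨i, ?_⟩
  have := cs.geomRep_single_nonneg hM (w * cs.simple i) i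
    (cs.isRightDescent_iff_not_isRightDescent_mul.1 hi)
  rwa [map_mul, Module.End.mul_apply, geomRep_simple, M.rootReflection_single_self, map_neg,
    le_neg, neg_zero] at this

theorem geomRep_injective_apply (w : W) : Function.Injective (cs.geomRep hM w) := by
  apply Function.LeftInverse.injective (g := cs.geomRep hM w⁻¹)
  intro v
  rw [← Module.End.mul_apply, ← map_mul, inv_mul_cancel, map_one, Module.End.one_apply]

theorem det_geomRep_of_lengthParity_eq_one {w : W} (hw : cs.lengthParity w = 1) :
    LinearMap.det (cs.geomRep hM w) = 1 := by
  have h : ∀ w, (LinearMap.det (cs.geomRep hM w) = 1 ∧ cs.lengthParity w = 1) ∨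
      (LinearMap.det (cs.geomRep hM w) = -1 ∧ cs.lengthParity w = Multiplicative.ofAdd 1) := by
    intro w
    induction w using cs.simple_induction_left with
    | one => simp
    | mul_simple_left w i ih =>
      rw [map_mul, map_mul, map_mul, geomRep_simple, M.det_rootReflection, lengthParity_simple]
      rcases ih with ⟨h1, h2⟩ | ⟨h1, h2⟩
      · right; simp [h1, h2]
      · left; rw [h1, h2]; exact ⟨by norm_num, rfl⟩
  rcases h w with h | ⟨_, h⟩
  · exact h.1
  · rw [hw] at h
    exact absurd h (by decide)

/-- If `w` commutes with `s_i s_j`, then it preserves the plane spanned by `α_i` and `α_j`. -/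
theorem geomRep_single_apply_eq_zero {w : W} {i j l : B} (hij : i ≠ j) (hli : l ≠ i) (hlj : l ≠ j)
    (hw : Commute w (cs.simple i * cs.simple j)) :
    cs.geomRep hM w (Pi.single i 1) l = 0 := by
  have hs := M.sin_pi_div_pos hij (hM i j)
  set F := cs.geomRep hM w
  set θ := Real.pi / (M i j : ℝ) with hθ
  have hsc := Real.sin_sq_add_cos_sq θ
  have hc : ∀ v, F (M.rootReflection i (M.rootReflection j v)) =
      M.rootReflection i (M.rootReflection j (F v)) := fun v => by
    have := congrArg (fun g => cs.geomRep hM g v) hw.eq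
    simpa [geomRep_simple] using this
  -- This `v` is orthogonal to `α_j`, so `v - s_i s_j v` is a nonzero multiple of `α_i`. Applying
  -- `F`, which commutes with `s_i s_j`, puts `F α_i` in the image of `1 - s_i s_j`, hence in the
  -- plane.
  set v : B → ℝ := Pi.single i 1 + Real.cos θ • Pi.single j 1 with hv
  have h1 : M.rootReflection i (M.rootReflection j v) =
      v - (2 * Real.sin θ ^ 2) • Pi.single i 1 := by
    simp only [hv, map_add, map_smul, M.rootReflection_single_self, M.rootReflection_single,
      M.symmetric j i, ← hθ, map_neg]
    rw [show Real.sin θ ^ 2 = 1 - Real.cos θ ^ 2 by linarith]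
    module
  have h2 := hc v
  rw [h1, map_sub, map_smul] at h2
  have h3 := congrFun h2 l
  simp only [M.rootReflection_apply, Pi.sub_apply, Pi.smul_apply, Pi.single_eq_of_ne hli,
    Pi.single_eq_of_ne hlj, smul_eq_mul, mul_zero, sub_zero] at h3
  have h4 : 2 * Real.sin θ ^ 2 * F (Pi.single i 1) l = 0 := by linarith
  have : 2 * Real.sin θ ^ 2 ≠ 0 := by positivity
  exact (mul_eq_zero.1 h4).resolve_left this

/-- Comparing `α_i`-coordinates in the commutation relation applied to `α_j` gives `(a - b) cos θ =
0`, and `cos θ ≠ 0` because the label is at least `3`. -/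
theorem eigenvalue_eq_of_commute {w : W} {i j : B} (hij : i ≠ j) (h2 : M i j ≠ 2)
    (hw : Commute w (cs.simple i * cs.simple j)) {a b : ℝ}
    (ha : cs.geomRep hM w (Pi.single i 1) = a • Pi.single i 1)
    (hb : cs.geomRep hM w (Pi.single j 1) = b • Pi.single j 1) : a = b := by
  have h := congrArg (fun g => cs.geomRep hM g (Pi.single j 1) i) hw.eq
  simp only [map_mul, Module.End.mul_apply, geomRep_simple, M.rootReflection_single_self,
    M.rootReflection_single, map_neg, map_add, map_smul, hb, ha] at h
  simp [hij] at h
  have hc : 0 < Real.cos (Real.pi / M i j) := by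
    have h1 : M i j ≠ 1 := M.off_diagonal i j hij
    have h0 := hM i j
    have h3 : (3 : ℝ) ≤ M i j := by exact_mod_cast (by omega : 3 ≤ M i j)
    have hpi := Real.pi_pos
    apply Real.cos_pos_of_mem_Ioo
    constructor
    · have : 0 < Real.pi / M i j := by positivity
      linarith
    · rw [div_lt_iff₀ (by positivity)]
      nlinarith
  have h' : (a - b) * Real.cos (Real.pi / M i j) = 0 := by linarith
  exact sub_eq_zero.1 ((mul_eq_zero.1 h').resolve_right hc.ne')

end CoxeterSystem

/-! ### The kernel of `J(k, n, m) → W_{k,n,m}^+` -/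

namespace ParentJ

variable (a b c : ℕ)

/-- The element `stu`. -/
def stu : ParentJ a b c := s a b c * t a b c * u a b c

variable {a b c}

theorem eq_top_of_mem {H : Subgroup (ParentJ a b c)} (hs : s a b c ∈ H) (ht : t a b c ∈ H)
    (hu : u a b c ∈ H) : H = ⊤ := by
  rw [eq_top_iff, ← PresentedGroup.closure_range_of, Subgroup.closure_le]
  rintro _ ⟨i, rfl⟩
  fin_cases i
  exacts [hs, ht, hu]

theorem hom_ext {H : Type*} [Group H] {f g : ParentJ a b c →* H} (hs : f (s a b c) = g (s a b c))
    (ht : f (t a b c) = g (t a b c)) (hu : f (u a b c) = g (u a b c)) : f = g := by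
  refine PresentedGroup.ext fun i => ?_
  fin_cases i
  exacts [hs, ht, hu]

/-- The homomorphism out of `J(a, b, c)` given by the images of `s`, `t`, `u`. -/
def lift {H : Type*} [Group H] (x y z : H) (hx : x ^ a = 1) (hy : y ^ b = 1) (hz : z ^ c = 1)
    (h₁ : x * y * z = y * z * x) (h₂ : y * z * x = z * x * y) : ParentJ a b c →* H :=
  PresentedGroup.toGroup (f := ![x, y, z]) <| by
    intro r hr
    simp only [parentJRels, Set.mem_insert_iff, Set.mem_singleton_iff] at hr
    rcases hr with rfl | rfl | rfl | rfl | rfl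
    · simpa using hx
    · simpa using hy
    · simpa using hz
    · rw [map_mul, map_inv, mul_inv_eq_one]
      simpa using h₁
    · rw [map_mul, map_inv, mul_inv_eq_one]
      simpa using h₂

section

variable {H : Type*} [Group H] (x y z : H) (hx : x ^ a = 1) (hy : y ^ b = 1) (hz : z ^ c = 1)
    (h₁ : x * y * z = y * z * x) (h₂ : y * z * x = z * x * y)

theorem lift_s : lift x y z hx hy hz h₁ h₂ (s a b c) = x := PresentedGroup.toGroup.of _

theorem lift_t : lift x y z hx hy hz h₁ h₂ (t a b c) = y := PresentedGroup.toGroup.of _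

theorem lift_u : lift x y z hx hy hz h₁ h₂ (u a b c) = z := PresentedGroup.toGroup.of _

end

variable (a b c)

theorem stu_mem_center : stu a b c ∈ Subgroup.center (ParentJ a b c) := by
  have h1 := stu_eq_tus a b c
  have h2 := tus_eq_ust a b c
  have : Subgroup.centralizer {stu a b c} = ⊤ := by
    apply eq_top_of_mem <;> rw [Subgroup.mem_centralizer_singleton_iff, stu]
    · calc s a b c * (s a b c * t a b c * u a b c)
          = s a b c * (t a b c * u a b c * s a b c) := by rw [h1]
        _ = s a b c * t a b c * u a b c * s a b c := by simp only [mul_assoc]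
    · exact (parentJ_commute_t a b c).eq
    · calc u a b c * (s a b c * t a b c * u a b c)
          = u a b c * s a b c * t a b c * u a b c := by simp only [mul_assoc]
        _ = s a b c * t a b c * u a b c * u a b c := by rw [h1, h2]
  rw [Subgroup.mem_center_iff]
  intro g
  have hg : g ∈ Subgroup.centralizer {stu a b c} := this ▸ Subgroup.mem_top g
  exact Subgroup.mem_centralizer_singleton_iff.1 hg

theorem stu_commute (g : ParentJ a b c) : Commute (stu a b c) g :=
  (Subgroup.mem_center_iff.1 (stu_mem_center a b c) g).symm

theorem u_eq : u a b c = (s a b c * t a b c)⁻¹ * stu a b c := by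
  rw [stu, inv_mul_cancel_left]

/-- The involution of `J(a, b, c)` that inverts `s`, `t` and `stu`. -/
def invol : ParentJ a b c →* ParentJ a b c :=
  -- The image of `u` is forced: it must be `(s⁻¹t⁻¹)⁻¹(stu)⁻¹ = ts(stu)⁻¹`, which equals `s⁻¹u⁻¹s`.
  lift (s a b c)⁻¹ (t a b c)⁻¹ ((s a b c)⁻¹ * (u a b c)⁻¹ * s a b c)
    (by rw [inv_pow, s_pow, inv_one]) (by rw [inv_pow, t_pow, inv_one])
    (by
      have := conj_pow (a := (s a b c)⁻¹) (b := (u a b c)⁻¹) (i := c)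
      rw [inv_inv] at this
      rw [this, inv_pow, u_pow]
      simp)
    (by
      have h := (stu_commute a b c (s a b c)).inv_left.eq
      rw [stu, stu_eq_tus, tus_eq_ust, mul_inv_rev, mul_inv_rev] at h
      simp only [mul_assoc, mul_inv_cancel, mul_one] at h ⊢
      rw [h, inv_mul_cancel_left])
    (by
      have h : (u a b c * s a b c * t a b c)⁻¹ = (t a b c * u a b c * s a b c)⁻¹ := by
        rw [tus_eq_ust]
      simp only [mul_inv_rev, mul_assoc] at h
      simp only [mul_assoc, mul_inv_cancel, mul_one, h])

theorem invol_invol (g : ParentJ a b c) : invol a b c (invol a b c g) = g := by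
  suffices h : (invol a b c).comp (invol a b c) = MonoidHom.id _ from DFunLike.congr_fun h g
  apply hom_ext <;> simp [invol, lift_s, lift_t, lift_u, mul_assoc]

theorem invol_stu : invol a b c (stu a b c) = (stu a b c)⁻¹ := by
  have h : (stu a b c)⁻¹ = (t a b c)⁻¹ * (s a b c)⁻¹ * (u a b c)⁻¹ := by
    rw [stu, stu_eq_tus, tus_eq_ust]
    simp [mul_assoc]
  have h2 := (stu_commute a b c (s a b c)).inv_left.eq
  rw [stu, map_mul, map_mul, invol, lift_s, lift_t, lift_u, ← stu]
  calc _ = (s a b c)⁻¹ * (((t a b c)⁻¹ * (s a b c)⁻¹ * (u a b c)⁻¹) * s a b c) := by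
        simp only [mul_assoc]
    _ = _ := by rw [← h, h2, inv_mul_cancel_left]

/-- The permutation of `J(a, b, c) / ⟨stu⟩` induced by the involution of `J(a, b, c)`. -/
def involPerm : Equiv.Perm (ParentJ a b c ⧸ Subgroup.zpowers (stu a b c)) :=
  Function.Involutive.toPerm
    (Quotient.map' (invol a b c) fun g h hgh => by
      rw [QuotientGroup.leftRel_apply] at hgh ⊢
      rw [← map_inv, ← map_mul]
      obtain ⟨i, hi⟩ := hgh
      refine ⟨-i, ?_⟩
      simp only at hi ⊢
      rw [← hi, map_zpow, invol_stu, inv_zpow, zpow_neg])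
    (by
      intro q
      induction q using Quotient.inductionOn' with
      | h g => exact congrArg _ (invol_invol a b c g))

theorem involPerm_mk (g : ParentJ a b c) :
    involPerm a b c (QuotientGroup.mk g) = QuotientGroup.mk (invol a b c g) := rfl

theorem involPerm_mul_self : involPerm a b c * involPerm a b c = 1 := by
  ext q
  induction q using QuotientGroup.induction_on with
  | H g => rw [Equiv.Perm.mul_apply, involPerm_mk, involPerm_mk, invol_invol, Equiv.Perm.one_apply]

/-- `J(a, b, c)` acting on the cosets of `⟨stu⟩`. -/
def cosetHom : ParentJ a b c →* Equiv.Perm (ParentJ a b c ⧸ Subgroup.zpowers (stu a b c)) :=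
  MulAction.toPermHom _ _

theorem cosetHom_apply_mk (g h : ParentJ a b c) :
    cosetHom a b c g (QuotientGroup.mk h) = QuotientGroup.mk (g * h) := rfl

theorem involPerm_mul_cosetHom (g : ParentJ a b c) :
    involPerm a b c * cosetHom a b c g = cosetHom a b c (invol a b c g) * involPerm a b c := by
  ext q
  induction q using QuotientGroup.induction_on with
  | H h =>
    simp only [Equiv.Perm.mul_apply, involPerm_mk, cosetHom_apply_mk, map_mul]

theorem cosetHom_stu : cosetHom a b c (stu a b c) = 1 := by
  ext q
  induction q using QuotientGroup.induction_on with
  | H h =>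
    rw [cosetHom_apply_mk, (stu_commute a b c h).eq, Equiv.Perm.one_apply, QuotientGroup.mk_mul_of_mem]
    exact Subgroup.mem_zpowers _

theorem mem_zpowers_of_cosetHom_eq_one {g : ParentJ a b c} (h : cosetHom a b c g = 1) :
    g ∈ Subgroup.zpowers (stu a b c) := by
  have := DFunLike.congr_fun h (QuotientGroup.mk 1)
  rw [cosetHom_apply_mk, Equiv.Perm.one_apply, mul_one, QuotientGroup.eq, mul_one] at this
  simpa using this

end ParentJ

theorem pow_mul_swap_eq_one {H : Type*} [Group H] {x y : H} {l : ℕ} (h : (x * y) ^ l = 1) :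
    (y * x) ^ l = 1 := by
  have := conj_pow (a := y) (b := x * y) (i := l)
  rw [h] at this
  simpa [mul_assoc] using this

/-! ### The coset action of the triangle group, and kernel and image of `p` -/

section Triangle

variable {k n m : ℕ} (hk : 2 ≤ k) (hn : 2 ≤ n) (hm : 2 ≤ m)

open ParentJ in
/-- The action of `W_{k,n,m}` on the cosets of `⟨stu⟩` in `J(k, n, m)`. -/
def triangleToPerm : TriangleCoxeter k n m hk hn hm →*
    Equiv.Perm (ParentJ k n m ⧸ Subgroup.zpowers (stu k n m)) :=
  (triangleMatrix k n m hk hn hm).toCoxeterSystem.lift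
    -- With `r₂` acting as the involution, these choices make `r₁r₂` and `r₂r₃` act as `s` and `t`.
    ⟨![cosetHom k n m (s k n m) * involPerm k n m, involPerm k n m,
        involPerm k n m * cosetHom k n m (t k n m)], by
      have hT := involPerm_mul_self k n m
      have h0 : (cosetHom k n m (s k n m) * involPerm k n m) *
          (cosetHom k n m (s k n m) * involPerm k n m) = 1 := by
        rw [mul_assoc, ← mul_assoc (involPerm k n m), involPerm_mul_cosetHom, mul_assoc, hT,
          mul_one, ← map_mul, invol, lift_s, mul_inv_cancel, map_one]
      have h2 : (involPerm k n m * cosetHom k n m (t k n m)) *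
          (involPerm k n m * cosetHom k n m (t k n m)) = 1 := by
        rw [mul_assoc, involPerm_mul_cosetHom, ← mul_assoc (cosetHom _ _ _ _), ← map_mul, invol,
          lift_t, mul_inv_cancel, map_one, one_mul, hT]
      have h01 : (cosetHom k n m (s k n m) * involPerm k n m * involPerm k n m) ^ k = 1 := by
        rw [mul_assoc, hT, mul_one, ← map_pow, s_pow, map_one]
      have h12 : (involPerm k n m * (involPerm k n m * cosetHom k n m (t k n m))) ^ n = 1 := by
        rw [← mul_assoc, hT, one_mul, ← map_pow, t_pow, map_one]
      -- Here `r₃r₁` acts as the involution's image of `ts`, namely `u(stu)⁻¹`, and `stu` acts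
      -- trivially on cosets.
      have h20 : (involPerm k n m * cosetHom k n m (t k n m) *
          (cosetHom k n m (s k n m) * involPerm k n m)) ^ m = 1 := by
        rw [mul_assoc, ← mul_assoc (cosetHom _ _ _ _), ← map_mul, ← mul_assoc,
          involPerm_mul_cosetHom, mul_assoc, hT, mul_one, ← map_pow]
        have : invol k n m (t k n m * s k n m) = u k n m * (stu k n m)⁻¹ := by
          rw [u_eq, mul_inv_cancel_right, map_mul, invol, lift_s, lift_t, mul_inv_rev]
        rw [this, ((stu_commute k n m _).inv_left.symm).mul_pow, u_pow, one_mul, map_pow, map_inv,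
          cosetHom_stu, inv_one, one_pow]
      intro i j
      fin_cases i <;> fin_cases j
      · simpa [triangleMatrix] using! h0
      · simpa [triangleMatrix] using! h01
      · simpa [triangleMatrix] using! pow_mul_swap_eq_one h20
      · simpa [triangleMatrix] using! pow_mul_swap_eq_one h01
      · simpa [triangleMatrix] using! hT
      · simpa [triangleMatrix] using! h12
      · simpa [triangleMatrix] using! h20
      · simpa [triangleMatrix] using! pow_mul_swap_eq_one h12
      · simpa [triangleMatrix] using! h2⟩

theorem parentJToAlt_s :
    parentJToAlt hk hn hm (ParentJ.s k n m) = triangleRot hk hn hm 0 1 :=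
  PresentedGroup.toGroup.of _

theorem parentJToAlt_t :
    parentJToAlt hk hn hm (ParentJ.t k n m) = triangleRot hk hn hm 1 2 :=
  PresentedGroup.toGroup.of _

theorem parentJToAlt_u :
    parentJToAlt hk hn hm (ParentJ.u k n m) = triangleRot hk hn hm 2 0 :=
  PresentedGroup.toGroup.of _

open ParentJ in
-- This bounds the kernel of `p`: an element killed by `p` must act trivially on the cosets of
-- `⟨stu⟩`.
theorem triangleToPerm_parentJToAlt (g : ParentJ k n m) :
    triangleToPerm hk hn hm (parentJToAlt hk hn hm g) = cosetHom k n m g := by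
  have hT := involPerm_mul_self k n m
  suffices h : (triangleToPerm hk hn hm).comp
      ((triangleAlt k n m hk hn hm).subtype.comp (parentJToAlt hk hn hm)) = cosetHom k n m from
    DFunLike.congr_fun h g
  have h0 : triangleToPerm hk hn hm (triangleR hk hn hm 0) =
    cosetHom k n m (s k n m) * involPerm k n m := CoxeterSystem.lift_apply_simple _ _ _
  have h1 : triangleToPerm hk hn hm (triangleR hk hn hm 1) = involPerm k n m :=
    CoxeterSystem.lift_apply_simple _ _ _
  have h2 : triangleToPerm hk hn hm (triangleR hk hn hm 2) =
    involPerm k n m * cosetHom k n m (t k n m) := CoxeterSystem.lift_apply_simple _ _ _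
  apply hom_ext
  · simp only [MonoidHom.comp_apply, Subgroup.subtype_apply, parentJToAlt_s, triangleRot, map_mul,
      h0, h1]
    rw [mul_assoc, hT, mul_one]
  · simp only [MonoidHom.comp_apply, Subgroup.subtype_apply, parentJToAlt_t, triangleRot, map_mul,
      h2, h1]
    rw [← mul_assoc, hT, one_mul]
  · simp only [MonoidHom.comp_apply, Subgroup.subtype_apply, parentJToAlt_u, triangleRot, map_mul,
      h2, h0]
    rw [mul_assoc, ← mul_assoc (cosetHom _ _ _ _), ← map_mul, ← mul_assoc,
      involPerm_mul_cosetHom, mul_assoc, hT, mul_one, map_mul (invol k n m), u_eq,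
      map_mul _ _ (stu k n m), cosetHom_stu, mul_one, invol, lift_s, lift_t, mul_inv_rev]

theorem parentJToAlt_stu : parentJToAlt hk hn hm (ParentJ.stu k n m) = 1 := by
  have e := triangleR_mul_self hk hn hm
  have e' : ∀ i y, triangleR hk hn hm i * (triangleR hk hn hm i * y) = y := fun i y => by
    rw [← mul_assoc, e, one_mul]
  rw [ParentJ.stu, map_mul, map_mul, parentJToAlt_s, parentJToAlt_t, parentJToAlt_u]
  simp [triangleRot, mul_assoc, e, e']

theorem ker_parentJToAlt :
    (parentJToAlt hk hn hm).ker = Subgroup.zpowers (ParentJ.stu k n m) := by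
  apply le_antisymm
  · intro g hg
    apply ParentJ.mem_zpowers_of_cosetHom_eq_one
    rw [← triangleToPerm_parentJToAlt hk hn hm, MonoidHom.mem_ker.1 hg]
    exact map_one _
  · rw [Subgroup.zpowers_le]
    exact parentJToAlt_stu hk hn hm

theorem triangleRot_mem_range (i j : Fin 3) :
    triangleRot hk hn hm i j ∈ (parentJToAlt hk hn hm).range := by
  have hd : ∀ i, triangleRot hk hn hm i i = 1 := fun i =>
    Subtype.ext (triangleR_mul_self hk hn hm i)
  have hi : ∀ i j, triangleRot hk hn hm i j = (triangleRot hk hn hm j i)⁻¹ := fun i j => by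
    have e := triangleR_mul_self hk hn hm
    rw [eq_inv_iff_mul_eq_one]
    apply Subtype.ext
    change triangleR hk hn hm i * triangleR hk hn hm j *
      (triangleR hk hn hm j * triangleR hk hn hm i) = 1
    rw [mul_assoc, ← mul_assoc (triangleR hk hn hm j), e, one_mul, e]
  have h01 : triangleRot hk hn hm 0 1 ∈ (parentJToAlt hk hn hm).range := ⟨_, parentJToAlt_s _ _ _⟩
  have h12 : triangleRot hk hn hm 1 2 ∈ (parentJToAlt hk hn hm).range := ⟨_, parentJToAlt_t _ _ _⟩
  have h20 : triangleRot hk hn hm 2 0 ∈ (parentJToAlt hk hn hm).range := ⟨_, parentJToAlt_u _ _ _⟩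
  fin_cases i <;> fin_cases j
  · exact hd 0 ▸ one_mem _
  · exact h01
  · exact hi 0 2 ▸ inv_mem h20
  · exact hi 1 0 ▸ inv_mem h01
  · exact hd 1 ▸ one_mem _
  · exact h12
  · exact h20
  · exact hi 2 1 ▸ inv_mem h12
  · exact hd 2 ▸ one_mem _

theorem parentJToAlt_surjective : Function.Surjective (parentJToAlt hk hn hm) := by
  set R := (parentJToAlt hk hn hm).range.map (triangleAlt k n m hk hn hm).subtype with hR
  have hrot : ∀ i j, triangleR hk hn hm i * triangleR hk hn hm j ∈ R := fun i j =>
    ⟨_, triangleRot_mem_range hk hn hm i j, rfl⟩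
  have e := triangleR_mul_self hk hn hm
  -- Left multiplication by a simple reflection swaps the two alternatives; parity later excludes
  -- the second for even `w`.
  have key : ∀ w, w ∈ R ∨ triangleR hk hn hm 1 * w ∈ R := by
    intro w
    induction w using
      (triangleMatrix k n m hk hn hm).toCoxeterSystem.simple_induction_left with
    | one => exact Or.inl (one_mem _)
    | mul_simple_left w i ih =>
      change triangleR hk hn hm i * w ∈ R ∨
        triangleR hk hn hm 1 * (triangleR hk hn hm i * w) ∈ R
      rcases ih with h | h
      · right
        rw [← mul_assoc]
        exact mul_mem (hrot _ _) h
      · left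
        have := mul_mem (hrot i 1) h
        rwa [mul_assoc, ← mul_assoc (triangleR hk hn hm 1), e, one_mul] at this
  rintro ⟨w, hw⟩
  rcases key w with h | h
  · obtain ⟨v, ⟨g, rfl⟩, hv⟩ := h
    exact ⟨g, Subtype.ext hv⟩
  · exfalso
    obtain ⟨v, -, hv⟩ := h
    have h1 : triangleR hk hn hm 1 * w ∈ triangleAlt k n m hk hn hm := hv ▸ v.2
    have h2 : triangleR hk hn hm 1 ∈ triangleAlt k n m hk hn hm :=
      ((triangleAlt k n m hk hn hm).mul_mem_cancel_right hw).1 h1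
    have h3 := (triangleMatrix k n m hk hn hm).toCoxeterSystem.lengthParity_simple 1
    exact absurd (h3.symm.trans (MonoidHom.mem_ker.1 h2)) (by decide)

end Triangle

/-! ### Injectivity of `W(k, n, m) → J(k, n, m)` -/

namespace ToricReflectionGroup

variable (k n m : ℕ)

theorem x_pow (i : ZMod n) : x k n m i ^ k = 1 := by
  have h := PresentedGroup.one_of_mem (rels := toricRels k n m)
    (x := FreeGroup.of i ^ k) (Or.inl ⟨i, rfl⟩)
  simpa [x, PresentedGroup.of] using h

/-- The product `x_i x_{i+1} ⋯` with `l` factors. -/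
def xProd (i : ZMod n) (l : ℕ) : ToricReflectionGroup k n m :=
  ((List.range l).map fun j : ℕ => x k n m (i + (j : ZMod n))).prod

theorem xProd_succ (i : ZMod n) (l : ℕ) :
    xProd k n m i (l + 1) = xProd k n m i l * x k n m (i + (l : ZMod n)) := by
  simp [xProd, List.range_succ]

theorem mk_toricWord (i : ZMod n) (l : ℕ) :
    PresentedGroup.mk (toricRels k n m) (toricWord n i l) = xProd k n m i l := by
  rw [toricWord, map_list_prod, List.map_map]
  rfl

theorem xProd_add_one (i : ZMod n) : xProd k n m (i + 1) m = xProd k n m i m := by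
  have h := PresentedGroup.one_of_mem (rels := toricRels k n m)
    (x := toricWord n i m * (toricWord n (i + 1) m)⁻¹) (Or.inr ⟨i, rfl⟩)
  rw [map_mul, map_inv, mul_inv_eq_one, mk_toricWord, mk_toricWord] at h
  exact h.symm

/-- The endomorphism `x_i ↦ x_{i + a}` of `W(k, n, m)`. -/
def shift (a : ZMod n) : ToricReflectionGroup k n m →* ToricReflectionGroup k n m :=
  PresentedGroup.toGroup (f := fun i => x k n m (i + a)) <| by
    have key : ∀ i, FreeGroup.lift (fun i => x k n m (i + a)) (toricWord n i m) =
        xProd k n m (i + a) m := fun i => by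
      rw [toricWord, map_list_prod, List.map_map, xProd]
      simp only [Function.comp_def, FreeGroup.lift_apply_of, add_right_comm]
    rintro r (⟨i, rfl⟩ | ⟨i, rfl⟩)
    · simpa using x_pow k n m (i + a)
    · rw [map_mul, map_inv, key, key, add_right_comm, xProd_add_one, mul_inv_cancel]

theorem shift_x (a i : ZMod n) : shift k n m a (x k n m i) = x k n m (i + a) :=
  PresentedGroup.toGroup.of _

theorem shift_shift (a b : ZMod n) (w : ToricReflectionGroup k n m) :
    shift k n m a (shift k n m b w) = shift k n m (b + a) w := by
  suffices h : (shift k n m a).comp (shift k n m b) = shift k n m (b + a) from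
    DFunLike.congr_fun h w
  refine PresentedGroup.ext fun i => ?_
  change shift k n m a (shift k n m b (x k n m i)) = shift k n m (b + a) (x k n m i)
  rw [shift_x, shift_x, shift_x, add_assoc]

theorem shift_zero (w : ToricReflectionGroup k n m) : shift k n m 0 w = w := by
  suffices h : shift k n m 0 = MonoidHom.id _ from DFunLike.congr_fun h w
  refine PresentedGroup.ext fun i => ?_
  change shift k n m 0 (x k n m i) = x k n m i
  rw [shift_x, add_zero]

theorem shift_xProd (i : ZMod n) (l : ℕ) :
    shift k n m 1 (xProd k n m i l) = xProd k n m (i + 1) l := by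
  rw [xProd, map_list_prod, List.map_map, xProd]
  simp only [Function.comp_def, shift_x, add_right_comm]

/-- The permutation of `W(k, n, m)` given by `x_i ↦ x_{i + 1}`. -/
def shiftPerm : Equiv.Perm (ToricReflectionGroup k n m) where
  toFun := shift k n m 1
  invFun := shift k n m (-1)
  left_inv w := by rw [shift_shift, add_neg_cancel, shift_zero]
  right_inv w := by rw [shift_shift, neg_add_cancel, shift_zero]

theorem shiftPerm_apply (w : ToricReflectionGroup k n m) : shiftPerm k n m w = shift k n m 1 w :=
  rfl

theorem shiftPerm_pow_apply (l : ℕ) (w : ToricReflectionGroup k n m) :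
    (shiftPerm k n m ^ l) w = shift k n m l w := by
  induction l with
  | zero => rw [pow_zero, Nat.cast_zero, shift_zero, Equiv.Perm.one_apply]
  | succ l ih => rw [pow_succ', Equiv.Perm.mul_apply, ih, shiftPerm_apply, shift_shift,
      Nat.cast_succ]

theorem shiftPerm_pow_self : shiftPerm k n m ^ n = 1 := by
  ext w
  rw [shiftPerm_pow_apply, ZMod.natCast_self, shift_zero, Equiv.Perm.one_apply]

/-- `W(k, n, m)` acting on itself by left multiplication. -/
def leftMul : ToricReflectionGroup k n m →* Equiv.Perm (ToricReflectionGroup k n m) :=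
  MulAction.toPermHom _ _

theorem leftMul_apply (v w : ToricReflectionGroup k n m) : leftMul k n m v w = v * w := rfl

theorem leftMul_injective : Function.Injective (leftMul k n m) := fun v w h => by
  simpa [leftMul_apply] using DFunLike.congr_fun h 1

theorem shiftPerm_pow_mul_leftMul (l : ℕ) (w : ToricReflectionGroup k n m) :
    shiftPerm k n m ^ l * leftMul k n m w =
      leftMul k n m (shift k n m l w) * shiftPerm k n m ^ l := by
  ext v
  simp only [Equiv.Perm.mul_apply, leftMul_apply, shiftPerm_pow_apply, map_mul]

theorem leftMul_mul_shiftPerm_pow (l : ℕ) :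
    (leftMul k n m (x k n m 1) * shiftPerm k n m) ^ l =
      leftMul k n m (xProd k n m 1 l) * shiftPerm k n m ^ l := by
  induction l with
  | zero => simp [xProd]
  | succ l ih =>
    rw [pow_succ, ih, mul_assoc, ← mul_assoc (shiftPerm k n m ^ l), shiftPerm_pow_mul_leftMul,
      shift_x, mul_assoc, ← pow_succ, ← mul_assoc, ← map_mul, ← xProd_succ]

/-- The permutation of `W(k, n, m)` which corresponds to `(st) ^ m`. -/
def twist : Equiv.Perm (ToricReflectionGroup k n m) :=
  (leftMul k n m (x k n m 1) * shiftPerm k n m) ^ m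

/-- The twist is `x₁⋯x_m σ^m`, and conjugating by `σ` replaces `x₁⋯x_m` by `x₂⋯x_{m+1}`, equal to it
by the defining relations. -/
theorem commute_shiftPerm_twist : Commute (shiftPerm k n m) (twist k n m) := by
  have h := shiftPerm_pow_mul_leftMul k n m 1 (xProd k n m 1 m)
  rw [pow_one, Nat.cast_one, shift_xProd, xProd_add_one] at h
  rw [Commute, SemiconjBy, twist, leftMul_mul_shiftPerm_pow, ← mul_assoc, h, mul_assoc, mul_assoc,
    ← pow_succ, pow_succ']

theorem commute_leftMul_twist : Commute (leftMul k n m (x k n m 1)) (twist k n m) := by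
  have h : Commute (leftMul k n m (x k n m 1) * shiftPerm k n m) (twist k n m) :=
    (Commute.refl _).pow_right _
  have := h.mul_left (commute_shiftPerm_twist k n m).inv_left
  rwa [mul_inv_cancel_right] at this

/-- The permutations that commute with `twist`. -/
abbrev TwistCentralizer : Type := Subgroup.centralizer {twist k n m}

/-- Left multiplication by `x_1`. -/
def centralS : TwistCentralizer k n m :=
  ⟨leftMul k n m (x k n m 1),
    Subgroup.mem_centralizer_singleton_iff.2 (commute_leftMul_twist k n m).eq⟩

/-- The shift, as an element of the centralizer of `twist`. -/
def centralT : TwistCentralizer k n m :=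
  ⟨shiftPerm k n m, Subgroup.mem_centralizer_singleton_iff.2 (commute_shiftPerm_twist k n m).eq⟩

/-- The subgroup generated by `((st) ^ m, -m)`. -/
def twistSubgroup : Subgroup (TwistCentralizer k n m × Multiplicative ℤ) :=
  Subgroup.zpowers ((centralS k n m * centralT k n m) ^ m, Multiplicative.ofAdd (-(m : ℤ)))

instance : (twistSubgroup k n m).Normal := by
  have hc : ∀ g ∈ twistSubgroup k n m, ∀ h, Commute h g := by
    rintro g ⟨i, rfl⟩ ⟨h₁, h₂⟩
    apply Commute.zpow_right
    apply Commute.prod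
    · have : Commute h₁.1 (twist k n m) := Subgroup.mem_centralizer_singleton_iff.1 h₁.2
      exact Subtype.ext this.eq
    · exact Commute.all _ _
  constructor
  intro g hg h
  rwa [(hc g hg h).eq, mul_inv_cancel_right]

/-- The group in which `(st) ^ m` gets a central `m`-th root. -/
abbrev RootExtension : Type := (TwistCentralizer k n m × Multiplicative ℤ) ⧸ twistSubgroup k n m

/-- The quotient map onto the group in which `(st) ^ m` has an `m`-th root. -/
def rootMk : TwistCentralizer k n m × Multiplicative ℤ →* RootExtension k n m :=
  QuotientGroup.mk' _

/-- The homomorphism from `J(k, n, m)` which sends `stu` to the `m`-th root of `(st) ^ m`. -/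
def parentJToRootExtension : ParentJ k n m →* RootExtension k n m :=
  ParentJ.lift (rootMk k n m (centralS k n m, 1)) (rootMk k n m (centralT k n m, 1))
    -- With `z` the class of `(1, 1)`, this is `(st)⁻¹z`; its `m`-th power is `(st)^{-m}z^m`,
    -- trivial in the quotient.
    (rootMk k n m ((centralS k n m * centralT k n m)⁻¹, Multiplicative.ofAdd 1))
    (by
      have : centralS k n m ^ k = 1 := Subtype.ext (by
        change leftMul k n m (x k n m 1) ^ k = 1
        rw [← map_pow, x_pow, map_one])
      rw [← map_pow, Prod.pow_mk, this, one_pow, Prod.mk_one_one, map_one])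
    (by
      have : centralT k n m ^ n = 1 := Subtype.ext (shiftPerm_pow_self k n m)
      rw [← map_pow, Prod.pow_mk, this, one_pow, Prod.mk_one_one, map_one])
    (by
      rw [← map_pow, rootMk, QuotientGroup.mk'_apply, QuotientGroup.eq_one_iff]
      refine ⟨-1, ?_⟩
      simp only [zpow_neg, zpow_one, Prod.inv_mk, Prod.pow_mk, inv_pow]
      rw [← ofAdd_neg, neg_neg, ← ofAdd_nsmul, nsmul_one])
    (by
      simp only [← map_mul, Prod.mk_mul_mk]
      congr 2
      group)
    (by
      simp only [← map_mul, Prod.mk_mul_mk]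
      congr 2
      group)

variable {k n m}

theorem toricToParentJ_x (hn : 2 ≤ n) (i : ZMod n) :
    toricToParentJ hn (x k n m i) = toricImage k n m i := PresentedGroup.toGroup.of _

/-- The composite with `ι` is left multiplication because conjugating `x₁` by `σ^{i-1}` gives `x_i`.
-/
theorem parentJToRootExtension_toricToParentJ (hn : 2 ≤ n) (w : ToricReflectionGroup k n m) :
    ∃ g : TwistCentralizer k n m, g.1 = leftMul k n m w ∧
      parentJToRootExtension k n m (toricToParentJ hn w) = rootMk k n m (g, 1) := by
  have : NeZero n := ⟨by omega⟩
  have hw : w ∈ Subgroup.closure (Set.range (PresentedGroup.of (rels := toricRels k n m))) := by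
    rw [PresentedGroup.closure_range_of]
    exact Subgroup.mem_top w
  induction hw using Subgroup.closure_induction with
  | mem w hw =>
    obtain ⟨i, rfl⟩ := hw
    refine ⟨centralT k n m ^ (i - 1).val * centralS k n m * (centralT k n m ^ (i - 1).val)⁻¹,
      ?_, ?_⟩
    · change shiftPerm k n m ^ (i - 1).val * leftMul k n m (x k n m 1) *
        (shiftPerm k n m ^ (i - 1).val)⁻¹ = leftMul k n m (x k n m i)
      rw [shiftPerm_pow_mul_leftMul, mul_inv_cancel_right, shift_x, ZMod.natCast_zmod_val,
        add_sub_cancel]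
    · change parentJToRootExtension k n m (toricToParentJ hn (x k n m i)) = _
      rw [toricToParentJ_x, toricImage, map_mul, map_mul, map_inv, map_pow, parentJToRootExtension,
        ParentJ.lift_s, ParentJ.lift_t, ← map_pow, ← map_inv, ← map_mul, ← map_mul]
      simp
  | one => exact ⟨1, by simp, by simp [← Prod.one_eq_mk]⟩
  | mul v w _ _ hv hw =>
    obtain ⟨g, hg, hg'⟩ := hv
    obtain ⟨h, hh, hh'⟩ := hw
    refine ⟨g * h, by rw [map_mul, ← hg, ← hh]; rfl, ?_⟩
    rw [map_mul, map_mul, hg', hh', ← map_mul, Prod.mk_mul_mk, mul_one]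
  | inv w _ hw =>
    obtain ⟨g, hg, hg'⟩ := hw
    refine ⟨g⁻¹, by rw [map_inv, ← hg]; rfl, ?_⟩
    rw [map_inv, map_inv, hg', ← map_inv, Prod.inv_mk, inv_one]

theorem toricToParentJ_injective (hn : 2 ≤ n) (hm : m ≠ 0) :
    Function.Injective (toricToParentJ (k := k) (m := m) hn) := by
  rw [injective_iff_map_eq_one]
  intro w hw
  obtain ⟨g, hg, hg'⟩ := parentJToRootExtension_toricToParentJ hn w
  rw [hw, map_one, eq_comm, rootMk, QuotientGroup.mk'_apply, QuotientGroup.eq_one_iff] at hg'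
  obtain ⟨i, hi⟩ := hg'
  simp only [Prod.pow_mk, Prod.mk.injEq] at hi
  obtain ⟨h1, h2⟩ := hi
  -- The integer coordinate is `-m i = 0`, so the centralizer meets the subgroup divided out
  -- trivially.
  rw [← ofAdd_zsmul, ofAdd_eq_one, smul_eq_mul, mul_neg, neg_eq_zero, mul_eq_zero] at h2
  have hi0 : i = 0 := h2.resolve_right (by exact_mod_cast hm)
  rw [hi0, zpow_zero] at h1
  apply leftMul_injective k n m
  rw [← hg, ← h1, map_one]
  rfl

/-! ### Kernel and image of `q` -/

theorem toricToParentJ_xProd (hn : 2 ≤ n) (l : ℕ) :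
    toricToParentJ hn (xProd k n m 1 l) =
      (ParentJ.s k n m * ParentJ.t k n m) ^ l * (ParentJ.t k n m ^ l)⁻¹ := by
  have : NeZero n := ⟨by omega⟩
  have h := toricImage_prod k n m 1 l
  simp only [sub_self, ZMod.val_zero, pow_zero, one_mul, inv_one, mul_one] at h
  rw [xProd, map_list_prod, List.map_map]
  simp only [Function.comp_def, toricToParentJ_x]
  exact h

theorem toricToParentJ_c (hn : 2 ≤ n) :
    toricToParentJ hn (c k n m) = ParentJ.stu k n m ^ (n * m) := by
  have h : c k n m = xProd k n m 1 n ^ m := rfl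
  rw [h, map_pow, toricToParentJ_xProd, ParentJ.t_pow, inv_one, mul_one, pow_right_comm,
    parentJ_st_pow, ← pow_mul, mul_comm m n]
  rfl

/-- The images of `s`, `t`, `u` under this map are `0`, `(1, 0)` and `(0, 1)`. -/
def parentJToZMod (k n m : ℕ) :
    ParentJ k n m →* Multiplicative (ZMod n × ZMod m) :=
  ParentJ.lift 1 (Multiplicative.ofAdd (1, 0)) (Multiplicative.ofAdd (0, 1)) (one_pow _)
    (by rw [← ofAdd_nsmul]; simp) (by rw [← ofAdd_nsmul]; simp) (by simp)
    (by simp [mul_comm])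

theorem parentJToZMod_toricToParentJ (hn : 2 ≤ n) (w : ToricReflectionGroup k n m) :
    parentJToZMod k n m (toricToParentJ hn w) = 1 := by
  suffices h : (parentJToZMod k n m).comp (toricToParentJ hn) = 1 from DFunLike.congr_fun h w
  refine PresentedGroup.ext fun i => ?_
  change parentJToZMod k n m (toricToParentJ hn (x k n m i)) = 1
  rw [toricToParentJ_x, toricImage]
  simp [parentJToZMod, ParentJ.lift_s]

/-- The image of `ι` dies in `ℤ/n × ℤ/m`, where `stu` becomes `(1, 1)`, of order `nm` by
coprimality. -/
theorem dvd_of_stu_zpow_mem_range (hn : 2 ≤ n) (hcop : Nat.Coprime n m) {i : ℤ}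
    {w : ToricReflectionGroup k n m} (h : toricToParentJ hn w = ParentJ.stu k n m ^ i) :
    ((n * m : ℕ) : ℤ) ∣ i := by
  have h1 := parentJToZMod_toricToParentJ hn w
  have h2 : parentJToZMod k n m (ParentJ.stu k n m) = Multiplicative.ofAdd (1, 1) := by
    rw [ParentJ.stu, map_mul, map_mul, parentJToZMod, ParentJ.lift_s, ParentJ.lift_t,
      ParentJ.lift_u, one_mul, ← ofAdd_add]
    simp
  rw [h, map_zpow, h2, ← ofAdd_zsmul, ofAdd_eq_one, Prod.smul_mk, Prod.mk_eq_zero, zsmul_one,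
    zsmul_one, ZMod.intCast_zmod_eq_zero_iff_dvd, ZMod.intCast_zmod_eq_zero_iff_dvd] at h1
  push_cast
  exact (Nat.isCoprime_iff_coprime.2 hcop).mul_dvd h1.1 h1.2

theorem ker_toricToAlt (hk : 2 ≤ k) (hn : 2 ≤ n) (hm : 2 ≤ m) (hcop : Nat.Coprime n m) :
    (toricToAlt hk hn hm).ker = Subgroup.zpowers (c k n m) := by
  apply le_antisymm
  · intro w hw
    have h1 : toricToParentJ hn w ∈ (parentJToAlt hk hn hm).ker := hw
    rw [ker_parentJToAlt] at h1
    obtain ⟨i, hi⟩ := h1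
    obtain ⟨j, rfl⟩ := dvd_of_stu_zpow_mem_range hn hcop hi.symm
    refine ⟨j, toricToParentJ_injective hn (by omega) ?_⟩
    simp only at hi ⊢
    rw [map_zpow, toricToParentJ_c, ← hi, zpow_mul, zpow_natCast]
  · rw [Subgroup.zpowers_le]
    exact toricToAlt_c hk hn hm

theorem toricToAlt_surjective (hk : 2 ≤ k) (hn : 2 ≤ n) (hm : 2 ≤ m) (hcop : Nat.Coprime n m) :
    Function.Surjective (toricToAlt (k := k) hk hn hm) := by
  set p := parentJToAlt (k := k) hk hn hm with hp
  set R := (toricToAlt (k := k) hk hn hm).range.comap p with hR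
  have hz : ParentJ.stu k n m ∈ R := ⟨1, by rw [map_one, hp, parentJToAlt_stu]⟩
  have hs : ParentJ.s k n m ∈ R := by
    refine ⟨x k n m 1, ?_⟩
    rw [toricToAlt, MonoidHom.comp_apply, toricToParentJ_x, toricImage]
    simp [hp]
  -- The word `x₁⋯x_m` maps to `(stu)^m t^{-m}`, and `stu` is already in `R`. Bézout with `t^n = 1`
  -- then yields `t`.
  have htm : ParentJ.t k n m ^ m ∈ R := by
    have h : toricToParentJ hn (xProd k n m 1 m) ∈ R := ⟨xProd k n m 1 m, rfl⟩
    rw [toricToParentJ_xProd, parentJ_st_pow] at h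
    exact inv_mem_iff.1 ((R.mul_mem_cancel_left (pow_mem hz m)).1 h)
  have ht : ParentJ.t k n m ∈ R := by
    have hb := Nat.gcd_eq_gcd_ab n m
    rw [hcop, Nat.cast_one] at hb
    have : ParentJ.t k n m =
        (ParentJ.t k n m ^ n) ^ (Nat.gcdA n m) * (ParentJ.t k n m ^ m) ^ (Nat.gcdB n m) := by
      rw [← zpow_natCast, ← zpow_natCast, ← zpow_mul, ← zpow_mul, ← zpow_add, ← hb, zpow_one]
    rw [this, ParentJ.t_pow, one_zpow, one_mul]
    exact zpow_mem htm _
  have hu : ParentJ.u k n m ∈ R := by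
    rw [ParentJ.u_eq]
    exact mul_mem (inv_mem (mul_mem hs ht)) hz
  have htop := ParentJ.eq_top_of_mem hs ht hu
  intro w
  obtain ⟨g, rfl⟩ := parentJToAlt_surjective hk hn hm w
  have : g ∈ R := htop ▸ Subgroup.mem_top g
  exact this

end ToricReflectionGroup

/-! ### The center of `W_{k,n,m}^+` -/

/-- An element of a Coxeter group of rank three that commutes with the products of any two simple
reflections acts diagonally on the simple roots. -/
theorem CoxeterSystem.exists_geomRep_single_eq_smul {W : Type*} [Group W]
    {M : CoxeterMatrix (Fin 3)} (cs : CoxeterSystem M W) (hM : ∀ i j, M i j ≠ 0) {w : W}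
    (hw : ∀ i j, Commute w (cs.simple i * cs.simple j)) :
    ∃ a : Fin 3 → ℝ, (∀ i, cs.geomRep hM w (Pi.single i 1) = a i • Pi.single i 1) ∧
      (∀ i, a i ≠ 0) ∧ LinearMap.det (cs.geomRep hM w) = ∏ i, a i := by
  -- In rank three, `l ≠ i` leaves a third index `j`; the plane of `α_i, α_j` is preserved and
  -- misses `α_l`.
  have h3 : ∀ i l : Fin 3, l ≠ i → ∃ j, i ≠ j ∧ l ≠ j := by decide
  set a : Fin 3 → ℝ := fun i => cs.geomRep hM w (Pi.single i 1) i with ha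
  have hd : ∀ i, cs.geomRep hM w (Pi.single i 1) = a i • Pi.single i 1 := fun i => by
    ext l
    rcases eq_or_ne l i with rfl | hl
    · simp [ha]
    · obtain ⟨j, hij, hlj⟩ := h3 i l hl
      rw [cs.geomRep_single_apply_eq_zero hM hij hl hlj (hw i j)]
      simp [hl]
  refine ⟨a, hd, fun i h0 => ?_, ?_⟩
  · have h1 := hd i
    rw [h0, zero_smul, ← map_zero (cs.geomRep hM w)] at h1
    have := congrFun (cs.geomRep_injective_apply hM w h1) i
    simp at this
  · have : LinearMap.toMatrix' (cs.geomRep hM w) = Matrix.diagonal a := by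
      ext l i
      rw [LinearMap.toMatrix'_apply, Matrix.diagonal_apply]
      have h1 := congrFun (hd i) l
      rcases eq_or_ne l i with rfl | hl
      · simpa using! h1
      · simpa [hl] using! h1
    rw [← LinearMap.det_toMatrix', this, Matrix.det_diagonal]

theorem CoxeterSystem.eq_one_of_geomRep_single_eq_smul {B W : Type*} [Fintype B] [DecidableEq B]
    [Group W] {M : CoxeterMatrix B} (cs : CoxeterSystem M W) (hM : ∀ i j, M i j ≠ 0) {w : W}
    {a : B → ℝ} (hw : ∀ i, cs.geomRep hM w (Pi.single i 1) = a i • Pi.single i 1)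
    (ha : ∀ i, 0 < a i) : w = 1 := by
  by_contra hne
  obtain ⟨i, hi⟩ := cs.exists_geomRep_single_nonpos hM hne
  rw [hw] at hi
  have h := hi i
  simp only [Pi.smul_apply, Pi.single_eq_same, smul_eq_mul, mul_one, Pi.zero_apply] at h
  exact absurd (ha i) (not_lt.2 h)

theorem CoxeterSystem.simple_ne_simple {B W : Type*} [Fintype B] [DecidableEq B]
    [Group W] {M : CoxeterMatrix B} (cs : CoxeterSystem M W) (hM : ∀ i j, M i j ≠ 0) {i j : B}
    (hij : i ≠ j) : cs.simple i ≠ cs.simple j := by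
  intro h
  have h1 := congrArg (fun g => cs.geomRep hM g (Pi.single i 1) i) h
  simp only [geomRep_simple, M.rootReflection_single_self, M.rootReflection_single] at h1
  simp [hij] at h1
  norm_num at h1

/-- If `x` inverts `v ≠ 1` and `v ^ l = 1` with `l` odd, then only `1` among the elements `v ^ j` and
`v ^ j * x` commutes with both `x` and `v`. -/
theorem eq_one_of_commute_of_odd {H : Type*} [Group H] {x v w : H} {l : ℕ} (hl : Odd l)
    (hv : v ^ l = 1) (hv1 : v ≠ 1) (hx : x * v * x⁻¹ = v⁻¹) (hwx : Commute w x)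
    (hwv : Commute w v) (hw : ∃ j : ℤ, w = v ^ j ∨ w = v ^ j * x) : w = 1 := by
  have odd_eq : ∀ g : H, g ^ l = 1 → g = g⁻¹ → g = 1 := fun g hg hg' => by
    obtain ⟨r, rfl⟩ := hl
    have h2 : g ^ 2 = 1 := by
      rw [pow_two]
      nth_rw 2 [hg']
      exact mul_inv_cancel g
    rwa [pow_succ, pow_mul, h2, one_pow, one_mul] at hg
  obtain ⟨j, rfl | rfl⟩ := hw
  · apply odd_eq
    · rw [← zpow_natCast, zpow_comm, zpow_natCast, hv, one_zpow]
    · have h1 : x * v ^ j * x⁻¹ = (v ^ j)⁻¹ := by rw [← conj_zpow, hx, inv_zpow]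
      rw [← h1, ← hwx.eq, mul_inv_cancel_right]
  -- If `v^j x` commutes with `v`, so does `x`; then `v = v⁻¹`, impossible for nontrivial `v` of odd
  -- order.
  · exfalso
    apply hv1
    apply odd_eq v hv
    have h1 : Commute (v ^ j) v := (Commute.refl v).zpow_left j
    have h2 := h1.inv_left.mul_left hwv
    rw [inv_mul_cancel_left] at h2
    rw [← hx, h2.eq, mul_inv_cancel_right]

/-- A central element has eigenvalues `a 0, a 1, a 2` with product `1`, and `m ≠ 2` gives `a 2 = a
0`, so `a 1 > 0`. Either all are positive and the element is trivial, or `a 0 < 0 < a 1`, which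
forces the labels `k` and `n` to be `2`. -/
theorem center_triangleAlt {k n m : ℕ} (hk : 2 ≤ k) (hn : 2 ≤ n) (hm : 2 ≤ m) (hm' : m ≠ 2)
    (hcop : Nat.Coprime n m) : Subgroup.center (triangleAlt k n m hk hn hm) = ⊥ := by
  rw [eq_bot_iff]
  intro w hw
  rw [Subgroup.mem_bot]
  rw [Subgroup.mem_center_iff] at hw
  set M := triangleMatrix k n m hk hn hm
  set cs := M.toCoxeterSystem
  have hM : ∀ i j, M i j ≠ 0 := by
    intro i j
    fin_cases i <;> fin_cases j <;> simp [M, triangleMatrix] <;> omega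
  have hc : ∀ i j, Commute w.1 (cs.simple i * cs.simple j) := fun i j =>
    (congrArg Subtype.val (hw (triangleRot hk hn hm i j))).symm
  obtain ⟨a, ha, ha0, hdet⟩ := cs.exists_geomRep_single_eq_smul hM hc
  rw [cs.det_geomRep_of_lengthParity_eq_one hM (MonoidHom.mem_ker.1 w.2), Fin.prod_univ_three]
    at hdet
  have h20 : a 2 = a 0 := cs.eigenvalue_eq_of_commute hM (i := 2) (j := 0) (by decide) (h2 := hm') (hc 2 0)
    (ha 2) (ha 0)
  have h1 : 0 < a 1 := by
    have h0 : 0 < a 0 ^ 2 := by have := ha0 0; positivity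
    have : a 0 ^ 2 * a 1 = 1 := by rw [hdet, h20]; ring
    exact (mul_pos_iff_of_pos_left h0).1 (this ▸ one_pos)
  rcases (ha0 0).lt_or_gt with h0 | h0
  · have hk2 : k = 2 := by
      by_contra h
      have := cs.eigenvalue_eq_of_commute hM (i := 0) (j := 1) (by decide) (h2 := h) (hc 0 1)
        (ha 0) (ha 1)
      linarith
    have hn2 : n = 2 := by
      by_contra h
      have := cs.eigenvalue_eq_of_commute hM (i := 1) (j := 2) (by decide) (h2 := h) (hc 1 2)
        (ha 1) (ha 2)
      linarith
    subst hk2 hn2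
    set p := parentJToAlt hk hn hm with hp
    set S := p (ParentJ.s 2 2 m)
    set T := p (ParentJ.t 2 2 m)
    set U := p (ParentJ.u 2 2 m)
    have hS : S * S = 1 := by rw [← map_mul, ← pow_two, ParentJ.s_pow, map_one]
    have hT : T * T = 1 := by rw [← map_mul, ← pow_two, ParentJ.t_pow, map_one]
    have hU : U ^ m = 1 := by rw [← map_pow, ParentJ.u_pow, map_one]
    have hSi : S⁻¹ = S := (eq_inv_of_mul_eq_one_left hS).symm
    have hTi : T⁻¹ = T := (eq_inv_of_mul_eq_one_left hT).symm
    have hSTU : S * T * U = 1 := by rw [← map_mul, ← map_mul]; exact parentJToAlt_stu hk hn hm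
    have hUe : U = T * S := by
      rw [← inv_eq_of_mul_eq_one_right hSTU, mul_inv_rev, hSi, hTi]
    have hSUS : S * U * S⁻¹ = U⁻¹ := by
      rw [hUe, mul_inv_rev, hSi, hTi, mul_assoc, mul_assoc, hS, mul_one]
    have hTe : T = U * S := by rw [hUe, mul_assoc, hS, mul_one]
    have hSU : ∀ j : ℤ, S * U ^ j = U ^ (-j) * S := fun j => by
      rw [← mul_inv_eq_iff_eq_mul, ← conj_zpow, hSUS, inv_zpow, zpow_neg]
    refine eq_one_of_commute_of_odd (x := S) (v := U) (l := m) ?_ hU ?_ hSUS (hw S).symm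
      (hw U).symm ?_
    · exact Nat.coprime_two_left.1 hcop
    · intro h
      have h2 : triangleR hk hn hm 2 * triangleR hk hn hm 0 = 1 :=
        congrArg Subtype.val ((parentJToAlt_u hk hn hm).symm.trans h)
      refine cs.simple_ne_simple hM (i := 2) (j := 0) (by decide) ?_
      rw [mul_eq_one_iff_eq_inv] at h2
      exact h2.trans (cs.inv_simple 0)
    -- The dihedral normal forms are closed under the group operations and contain the images of
    -- `s`, `t`, `u`, so they exhaust the group.
    · let D : Subgroup (triangleAlt 2 2 m hk hn hm) :=
        { carrier := {g | ∃ j : ℤ, g = U ^ j ∨ g = U ^ j * S}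
          one_mem' := ⟨0, Or.inl (zpow_zero U).symm⟩
          mul_mem' := by
            rintro _ _ ⟨i, rfl | rfl⟩ ⟨j, rfl | rfl⟩
            · exact ⟨i + j, Or.inl (zpow_add _ _ _).symm⟩
            · exact ⟨i + j, Or.inr (by rw [zpow_add, mul_assoc])⟩
            · exact ⟨i + -j, Or.inr (by rw [mul_assoc, hSU, zpow_add, mul_assoc])⟩
            · refine ⟨i + -j, Or.inl ?_⟩
              rw [mul_assoc, ← mul_assoc S, hSU, mul_assoc, hS, mul_one, zpow_add]
          inv_mem' := by
            rintro _ ⟨i, rfl | rfl⟩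
            · exact ⟨-i, Or.inl (zpow_neg _ _).symm⟩
            · refine ⟨i, Or.inr ?_⟩
              rw [mul_inv_rev, hSi, ← zpow_neg, hSU, neg_neg] }
      have hD : D.comap p = ⊤ := ParentJ.eq_top_of_mem
        ⟨0, Or.inr (by rw [zpow_zero, one_mul])⟩ ⟨1, Or.inr (by rw [zpow_one]; exact hTe)⟩
        ⟨1, Or.inl (zpow_one U).symm⟩
      obtain ⟨g, rfl⟩ := parentJToAlt_surjective hk hn hm w
      have hg : g ∈ D.comap p := hD ▸ Subgroup.mem_top g
      exact hg
  · apply Subtype.ext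
    refine cs.eq_one_of_geomRep_single_eq_smul hM ha fun i => ?_
    fin_cases i
    exacts [h0, h1, h20.symm ▸ h0]

/-! ### The main theorem -/

/-- A surjection carries central elements to central elements, which are trivial here. -/
theorem MonoidHom.center_eq_ker {G H : Type*} [Group G] [Group H] {f : G →* H}
    (hf : Function.Surjective f) (hker : f.ker ≤ Subgroup.center G)
    (hH : Subgroup.center H = ⊥) : Subgroup.center G = f.ker := by
  refine le_antisymm (fun g hg => ?_) hker
  rw [MonoidHom.mem_ker, ← Subgroup.mem_bot, ← hH, Subgroup.mem_center_iff]
  intro h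
  obtain ⟨g', rfl⟩ := hf h
  rw [← map_mul, ← map_mul, Subgroup.mem_center_iff.1 hg g']

theorem ToricReflectionGroup.c_mem_center {k n m : ℕ} (hn : 2 ≤ n) (hm : 2 ≤ m) :
    c k n m ∈ Subgroup.center (ToricReflectionGroup k n m) := by
  rw [Subgroup.mem_center_iff]
  intro w
  apply toricToParentJ_injective hn (by omega)
  rw [map_mul, map_mul, toricToParentJ_c, ((ParentJ.stu_commute k n m _).pow_left _).eq]

open ToricReflectionGroup in
theorem theorem3 (k n m : ℕ) (hk : 2 ≤ k) (hn : 2 ≤ n) (hm : 2 ≤ m) (hnm : n < m)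
    (hcop : Nat.Coprime n m) :
    let G := ParentJ k n m
    let W := ToricReflectionGroup k n m
    let c : W := ToricReflectionGroup.c k n m
    let stu : G := ParentJ.s k n m * ParentJ.t k n m * ParentJ.u k n m
    let ι : W →* G := toricToParentJ hn
    let p : G →* triangleAlt k n m hk hn hm := parentJToAlt hk hn hm
    let q : W →* triangleAlt k n m hk hn hm := toricToAlt hk hn hm
    -- (1) the map from the quotient of `W` by `c = 1` is an isomorphism
    Function.Bijective (toricPhi hk hn hm) ∧
    -- (2) first row of the diagram
    (Function.Injective (Subgroup.zpowers stu).subtype ∧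
      Function.MulExact (Subgroup.zpowers stu).subtype p ∧ Function.Surjective p) ∧
    -- second row of the diagram
    (Function.Injective (Subgroup.zpowers c).subtype ∧
      Function.MulExact (Subgroup.zpowers c).subtype q ∧ Function.Surjective q) ∧
    -- vertical maps are injective, and both squares commute
    (Function.Injective ι ∧ p.comp ι = q ∧
      ∃ κ : Subgroup.zpowers c →* Subgroup.zpowers stu, Function.Injective κ ∧
        (Subgroup.zpowers stu).subtype.comp κ = ι.comp (Subgroup.zpowers c).subtype) ∧
    -- (3) the centers, which are therefore cyclic
    (Subgroup.center W = Subgroup.zpowers c ∧ IsCyclic (Subgroup.center W) ∧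
      Subgroup.center G = Subgroup.zpowers stu ∧ IsCyclic (Subgroup.center G)) ∧
    -- (4) the isomorphisms induced by the diagram
    Subgroup.center W = Subgroup.normalClosure {c} ∧
    (∃ α : W ⧸ Subgroup.center W ≃* G ⧸ Subgroup.center G,
      ∀ w : W, α (QuotientGroup.mk w) = QuotientGroup.mk (ι w)) ∧
    (∃ β : G ⧸ Subgroup.center G ≃* triangleAlt k n m hk hn hm,
      ∀ g : G, β (QuotientGroup.mk g) = p g) ∧
    (∃ γ : W ⧸ Subgroup.center W ≃* triangleAlt k n m hk hn hm,
      ∀ w : W, γ (QuotientGroup.mk w) = q w) := by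

  intro G W c stu ι p q
  have hp : Function.Surjective p := parentJToAlt_surjective hk hn hm
  have hq : Function.Surjective q := toricToAlt_surjective hk hn hm hcop
  have hι : Function.Injective ι := toricToParentJ_injective hn (by omega)
  have hkp : p.ker = Subgroup.zpowers stu := ker_parentJToAlt hk hn hm
  have hkq : q.ker = Subgroup.zpowers c := ker_toricToAlt hk hn hm hcop
  -- The condition `m ≠ 2` comes from `2 ≤ n < m`.
  have hA := center_triangleAlt hk hn hm (by omega) hcop
  have hcc : Subgroup.zpowers c ≤ Subgroup.center W := by
    rw [Subgroup.zpowers_le]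
    exact c_mem_center hn hm
  have hsc : Subgroup.zpowers stu ≤ Subgroup.center G := by
    rw [Subgroup.zpowers_le]
    exact ParentJ.stu_mem_center k n m
  have hZW : Subgroup.center W = q.ker := MonoidHom.center_eq_ker hq (hkq ▸ hcc) hA
  have hZG : Subgroup.center G = p.ker := MonoidHom.center_eq_ker hp (hkp ▸ hsc) hA
  have hn' : Subgroup.normalClosure {c} = q.ker := by
    apply le_antisymm
    · apply Subgroup.normalClosure_le_normal
      rw [Set.singleton_subset_iff]
      exact toricToAlt_c hk hn hm
    · rw [hkq, Subgroup.zpowers_le]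
      exact Subgroup.subset_normalClosure rfl
  have hιc : ι c = stu ^ (n * m) := toricToParentJ_c hn
  have hβ : ∃ β : G ⧸ Subgroup.center G ≃* triangleAlt k n m hk hn hm,
      ∀ g : G, β (QuotientGroup.mk g) = p g :=
    ⟨(QuotientGroup.quotientMulEquivOfEq hZG).trans
      (QuotientGroup.quotientKerEquivOfSurjective p hp), fun g => rfl⟩
  have hγ : ∃ γ : W ⧸ Subgroup.center W ≃* triangleAlt k n m hk hn hm,
      ∀ w : W, γ (QuotientGroup.mk w) = q w :=
    ⟨(QuotientGroup.quotientMulEquivOfEq hZW).trans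
      (QuotientGroup.quotientKerEquivOfSurjective q hq), fun w => rfl⟩
  refine ⟨⟨?_, ?_⟩, ⟨Subtype.val_injective, ?_, hp⟩, ⟨Subtype.val_injective, ?_, hq⟩,
    ⟨hι, rfl, ?_⟩, ⟨hZW.trans hkq, ?_, hZG.trans hkp, ?_⟩, hZW.trans hn'.symm, ?_, hβ, hγ⟩
  · rw [injective_iff_map_eq_one]
    intro x hx
    induction x using QuotientGroup.induction_on with
    | H w =>
      rw [QuotientGroup.eq_one_iff]
      change w ∈ Subgroup.normalClosure {c}
      rw [hn']
      exact hx
  · intro x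
    obtain ⟨w, rfl⟩ := hq x
    exact ⟨QuotientGroup.mk w, rfl⟩
  · rw [MonoidHom.mulExact_iff, hkp, Subgroup.range_subtype]
  · rw [MonoidHom.mulExact_iff, hkq, Subgroup.range_subtype]
  · have hmem : ∀ w : Subgroup.zpowers c, (ι.comp (Subgroup.zpowers c).subtype) w ∈
        Subgroup.zpowers stu := by
      rintro ⟨_, i, rfl⟩
      -- The exponent comes from `ι(c) = (stu)^{nm}`.
      refine ⟨(n * m : ℕ) * i, ?_⟩
      change stu ^ (((n * m : ℕ) : ℤ) * i) = ι (c ^ i)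
      rw [map_zpow, hιc, zpow_mul, zpow_natCast]
    refine ⟨(ι.comp (Subgroup.zpowers c).subtype).codRestrict _ hmem, fun v w h => ?_, rfl⟩
    exact Subtype.ext (hι (congrArg Subtype.val h))
  · rw [hZW, hkq]
    infer_instance
  · rw [hZG, hkp]
    infer_instance
  · obtain ⟨β, hβ⟩ := hβ
    obtain ⟨γ, hγ⟩ := hγ
    refine ⟨γ.trans β.symm, fun w => ?_⟩
    rw [MulEquiv.trans_apply, MulEquiv.symm_apply_eq, hγ, hβ]
    rfl
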